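/- Fix $T>0$, $r\ge 0$, $d\in\mathbb N$, $N\ge 2$, a common risk tolerance $\bar\delta>0$, a symmetric positive definite matrix $\Sigma\in\mathbb R^{d\times d}$, a diagonal positive definite matrix $\Lambda\in\mathbb R^{d\times d}$, and a probability space $(\Omega,\mathcal F,\mathbf P)$ with a filtration $\mathbb F=(\mathcal F(t))_{t\in[0,T]}$ (for instance the augmented filtration of a $d$-dimensional Brownian motion). Let $\mathcal H^2$, respectively $\mathcal H^\infty$, be the optional $\mathbb R^d$-valued processes $X$ on $[0,T]$ with $\mathbb E\int_0^T\|X(t)\|_2^2\,dt<\infty$, respectively with $\|X\|_2$ essentially bounded in $(t,\omega)$. Let $\mathcal A$ be the set of continuous semimartingales $X\in\mathcal H^\infty$ with $dX(t)=a^X(t)\,dt+dM^X(t)$ and $X(T)=0$, where $a^X\in\mathcal H^\infty$ and $M^X\in\mathcal H^\infty$ is a continuous $\mathbb F$-martingale. Let $\mathcal W_{\mathcal A}$ be the set of processes $X$ with $dX(t)=\dot X(t)\,dt$, $X(0)=0$, $\dot X\in\mathcal A$. Let $\zeta_1,\dots,\zeta_N\in\mathcal H^\infty$ be the risk exposures of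 the investors $1,\dots,N$, let $\psi\in\mathcal W_{\mathcal A}$ be the demand of the noise traders, and put $\zeta_{-n}:=\sum_{m\ne n}\zeta_m$. Under returns $\nu\in\mathcal H^\infty$ the frictional objective of investor $n$ is $$\mathcal F_{\Lambda,n}(\dot\phi;\nu):=\mathbb E\Big[\int_0^Te^{-rt}\Big(\phi(t)'\nu(t)-\tfrac1{2\bar\delta}(\phi(t)+\zeta_n(t))'\Sigma(\phi(t)+\zeta_n(t))-\dot\phi(t)'\Lambda\dot\phi(t)\Big)dt\Big],\qquad \phi(t)=\int_0^t\dot\phi(s)\,ds,$$ and a competitive frictional strategy of investor $m$ is a pair $(\phi_m,\dot\phi_m)$ with $\dot\phi_m\in\mathcal H^2$ which, with some continuous square integrable $\mathbb F$-martingale $M_m$, solves $$d\phi_m=\dot\phi_m\,dt,\quad \phi_m(0)=0,\qquad d\dot\phi_m=dM_m+\tfrac{\Lambda^{-1}\Sigma}{2\bar\delta}\big(\phi_m-(\bar\delta\Sigma^{-1}\nu-\zeta_m)\big)dt+r\dot\phi_m\,dt,\quad \dot\phi_m(T)=0 .$$ Fix an investor $n$ and a demand $\phi\in\mathcal W_{\mathcal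 A}$ of investor $n$. Then: 1. The process $$\nu_n(t;\phi,\dot\phi):=\tfrac{2\Lambda}{N-1}\big(a^{\dot\phi}(t)-r\dot\phi(t)\big)+\tfrac{\Sigma(\zeta_{-n}(t)-\phi(t)-\psi(t))}{\bar\delta(N-1)}+\tfrac{2\Lambda}{N-1}\big(a^{\dot\psi}(t)-r\dot\psi(t)\big)$$ coincides $dt\otimes\mathbf P$-almost everywhere with an element of $\mathcal H^\infty$. Moreover, if $\nu\in\mathcal H^\infty$ and $(\phi_m,\dot\phi_m)$, $m\neq n$, are competitive frictional strategies under $\nu$, then the market clears, that is, almost surely $\phi(t)+\sum_{m\ne n}\phi_m(t)+\psi(t)=0$ and $\dot\phi(t)+\sum_{m\ne n}\dot\phi_m(t)+\dot\psi(t)=0$ for all $t\in[0,T]$, if and only if $\nu=\nu_n(\cdot\,;\phi,\dot\phi)$ $dt\otimes\mathbf P$-almost everywhere. 2. Whenever, in this situation, the market clears, the objective of investor $n$ becomes $\mathcal F_{\Lambda,n}(\dot\phi;\nu)=\widetilde{\mathcal F}_{\Lambda,n}(\dot\phi)$, where $\widetilde{\mathcal F}_{\Lambda,n}:\mathcal A\to\mathbb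 R$ is $$\widetilde{\mathcal F}_{\Lambda,n}(\dot\phi):=\mathbb E\Big[\int_0^Te^{-rt}\Big(\phi(t)'\Big(\tfrac{\Sigma(\zeta_{-n}(t)-\phi(t)-\psi(t))}{\bar\delta(N-1)}+\tfrac{2\Lambda}{N-1}\big(a^{\dot\psi}(t)-r\dot\psi(t)\big)\Big)-\tfrac1{2\bar\delta}(\phi(t)+\zeta_n(t))'\Sigma(\phi(t)+\zeta_n(t))-\dot\phi(t)'\Big(\Lambda+\tfrac{2\Lambda}{N-1}\Big)\dot\phi(t)\Big)dt\Big].$$ The integrand of $\widetilde{\mathcal F}_{\Lambda,n}(\dot\phi)$ is integrable on $[0,T]\times\Omega$ for every $\dot\phi\in\mathcal A$, and so is that of $\mathcal F_{\Lambda,n}(\dot\phi;\nu)$ when the market clears. -/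

import Mathlib

open MeasureTheory ProbabilityTheory Filter Topology
open scoped Matrix ENNReal

noncomputable section

namespace PriceImpact

/-- The trading period `[0, T]`. -/
abbrev Period (T : ℝ) : Type := Set.Icc (0 : ℝ) T

/-- Lebesgue measure on `[0, T]`. -/
def leb (T : ℝ) : Measure (Period T) := (volume : Measure ℝ).comap Subtype.val

/-- `ℝ^d`-valued processes on `[0, T]`, with the time argument first. -/
abbrev Proc (T : ℝ) (Ω : Type*) (d : ℕ) : Type _ := Period T → Ω → Fin d → ℝ

/-- The optional σ-algebra on `[0, T] × Ω`: the one generated by the real-valued adapted processes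
whose paths are right-continuous with left limits. -/
@[reducible] def optionalSigma {T : ℝ} {Ω : Type*} {mΩ : MeasurableSpace Ω}
    (ℱ : Filtration (Period T) mΩ) : MeasurableSpace (Period T × Ω) :=
  ⨆ Y ∈ {Y : Period T → Ω → ℝ | StronglyAdapted ℱ Y ∧
      (∀ ω t, ContinuousWithinAt (fun s => Y s ω) (Set.Ici t) t) ∧
      (∀ ω t, ∃ l : ℝ, Tendsto (fun s => Y s ω) (𝓝[<] t) (𝓝 l))},
    MeasurableSpace.comap (fun p : Period T × Ω => Y p.1 p.2) inferInstance

/-- The process `X` is optional. -/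
def IsOptional {T : ℝ} {Ω : Type*} {mΩ : MeasurableSpace Ω} {d : ℕ}
    (ℱ : Filtration (Period T) mΩ) (X : Proc T Ω d) : Prop :=
  Measurable[optionalSigma ℱ] (fun p : Period T × Ω => X p.1 p.2)

/-- The class `ℋ²`: optional processes with `E ∫₀ᵀ ‖X(t)‖₂² dt < ∞` (Euclidean norm). -/
def MemHTwo {T : ℝ} {Ω : Type*} {mΩ : MeasurableSpace Ω} {d : ℕ}
    (ℱ : Filtration (Period T) mΩ) (P : Measure Ω) (X : Proc T Ω d) : Prop :=
  IsOptional ℱ X ∧ (∫⁻ ω, (∫⁻ t, ‖WithLp.toLp 2 (X t ω)‖ₑ ^ 2 ∂(leb T)) ∂P) < ∞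

/-- The class `ℋ^∞`: optional processes, essentially bounded in `(t, ω)` (Euclidean norm). -/
def MemHInf {T : ℝ} {Ω : Type*} {mΩ : MeasurableSpace Ω} {d : ℕ}
    (ℱ : Filtration (Period T) mΩ) (P : Measure Ω) (X : Proc T Ω d) : Prop :=
  IsOptional ℱ X ∧ ∃ C : ℝ, ∀ᵐ ω ∂P, ∀ᵐ t ∂(leb T), ‖WithLp.toLp 2 (X t ω)‖ ≤ C

/-- `dX(t) = b(t) dt + dM(t)` on `[0, T]`, almost surely, in integrated form. -/
def HasDynamics {T : ℝ} {Ω : Type*} {mΩ : MeasurableSpace Ω} {d : ℕ}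
    (P : Measure Ω) (X b M : Proc T Ω d) : Prop :=
  ∀ᵐ ω ∂P, ∀ s t : Period T, s ≤ t →
    X t ω - X s ω = (∫ u in Set.Ioc s t, b u ω ∂(leb T)) + (M t ω - M s ω)

/-- `X(T) = 0` almost surely. -/
def TerminalZero {T : ℝ} {Ω : Type*} {mΩ : MeasurableSpace Ω} {d : ℕ}
    (P : Measure Ω) (X : Proc T Ω d) : Prop :=
  ∀ᵐ ω ∂P, ∀ t : Period T, (t : ℝ) = T → X t ω = 0

/-- The almost sure continuity of the paths of `M`. -/
def ContinuousPaths {T : ℝ} {Ω : Type*} {mΩ : MeasurableSpace Ω} {d : ℕ}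
    (P : Measure Ω) (M : Proc T Ω d) : Prop :=
  ∀ᵐ ω ∂P, Continuous (fun t => M t ω)

/-- `X` belongs to the class `𝒜`, with drift `a = a^X`: `X` is a bounded continuous semimartingale
with `dX = a dt + dM`, where `a ∈ ℋ^∞`, `M` is a continuous martingale in `ℋ^∞`, and `X(T) = 0`. -/
def MemA {T : ℝ} {Ω : Type*} {mΩ : MeasurableSpace Ω} {d : ℕ}
    (ℱ : Filtration (Period T) mΩ) (P : Measure Ω) (X a : Proc T Ω d) : Prop :=
  MemHInf ℱ P X ∧ MemHInf ℱ P a ∧ TerminalZero P X ∧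
    ∃ M : Proc T Ω d, Martingale M ℱ P ∧ ContinuousPaths P M ∧ MemHInf ℱ P M ∧
      HasDynamics P X a M

/-- `dφ(t) = φ̇(t) dt` and `φ(0) = 0`, i.e. `φ(t) = ∫₀ᵗ φ̇(s) ds` for all `t`, almost surely. -/
def IsPrimitive {T : ℝ} {Ω : Type*} {mΩ : MeasurableSpace Ω} {d : ℕ}
    (P : Measure Ω) (φ φdot : Proc T Ω d) : Prop :=
  ∀ᵐ ω ∂P, ∀ t : Period T, φ t ω = ∫ s in Set.Iic t, φdot s ω ∂(leb T)

/-- `φ` belongs to the class `𝒲_𝒜`, with rate `φ̇ ∈ 𝒜` whose drift is `a = a^φ̇`. -/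
def MemWA {T : ℝ} {Ω : Type*} {mΩ : MeasurableSpace Ω} {d : ℕ}
    (ℱ : Filtration (Period T) mΩ) (P : Measure Ω) (φ φdot a : Proc T Ω d) : Prop :=
  IsPrimitive P φ φdot ∧ MemA ℱ P φdot a

/-- The competitive frictionless portfolio `δ Σ⁻¹ ν - ζ`. -/
def frictionlessPortfolio {T : ℝ} {Ω : Type*} {d : ℕ} (δ : ℝ) (S : Matrix (Fin d) (Fin d) ℝ)
    (ζ ν : Proc T Ω d) : Proc T Ω d :=
  fun t ω => δ • (S⁻¹ *ᵥ ν t ω) - ζ t ω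

/-- `(φ, φ̇)` is the competitive frictional strategy under the return process `ν`, i.e. it solves
`dφ = φ̇ dt`, `φ(0) = 0`,
`dφ̇ = dM + (2δ)⁻¹ Λ⁻¹ Σ (φ - (δ Σ⁻¹ ν - ζ)) dt + r φ̇ dt`, `φ̇(T) = 0`,
with `φ̇ ∈ ℋ²` and a continuous square integrable martingale `M` which is part of the solution. -/
def SolvesCompetitiveFBSDE {T : ℝ} {Ω : Type*} {mΩ : MeasurableSpace Ω} {d : ℕ}
    (ℱ : Filtration (Period T) mΩ) (P : Measure Ω) (r δ : ℝ) (S L : Matrix (Fin d) (Fin d) ℝ)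
    (ζ ν φ φdot : Proc T Ω d) : Prop :=
  IsPrimitive P φ φdot ∧ MemHTwo ℱ P φdot ∧ TerminalZero P φdot ∧
    ∃ M : Proc T Ω d, Martingale M ℱ P ∧ (∀ t, MemLp (M t) 2 P) ∧ ContinuousPaths P M ∧
      HasDynamics P φdot
        (fun t ω => (1 / (2 * δ)) •
            ((L⁻¹ * S) *ᵥ (φ t ω - frictionlessPortfolio δ S ζ ν t ω)) + r • φdot t ω) M

/-- Market clearing, for demands and for trading rates, when investor `n` holds `φ`, every other
investor `m` holds `θ m`, and the noise traders hold `ψ`. -/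
def MarketClears {T : ℝ} {Ω : Type*} {mΩ : MeasurableSpace Ω} {d N : ℕ} (P : Measure Ω)
    (n : Fin N) (φ φdot : Proc T Ω d) (θ θdot : Fin N → Proc T Ω d) (ψ ψdot : Proc T Ω d) : Prop :=
  ∀ᵐ ω ∂P, ∀ t : Period T,
    φ t ω + ∑ m ∈ Finset.univ.erase n, θ m t ω + ψ t ω = 0 ∧
    φdot t ω + ∑ m ∈ Finset.univ.erase n, θdot m t ω + ψdot t ω = 0

/-- `E ∫₀ᵀ f(t) dt`. -/
def expectedIntegral {T : ℝ} {Ω : Type*} {mΩ : MeasurableSpace Ω} (P : Measure Ω)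
    (f : Period T → Ω → ℝ) : ℝ :=
  ∫ ω, (∫ t, f t ω ∂(leb T)) ∂P

/-- Integrability of `f` on `[0, T] × Ω`, so that `E ∫₀ᵀ f(t) dt` is meaningful. -/
def IsIntegrand {T : ℝ} {Ω : Type*} {mΩ : MeasurableSpace Ω} (P : Measure Ω)
    (f : Period T → Ω → ℝ) : Prop :=
  Integrable (fun p : Period T × Ω => f p.1 p.2) ((leb T).prod P)

/-- The integrand of the frictional objective functional under the return process `ν`:
`e^{-rt} (φ' ν - (2δ)⁻¹ (φ + ζ)' Σ (φ + ζ) - φ̇' Λ φ̇)`. -/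
def frIntegrand {T : ℝ} {Ω : Type*} {d : ℕ} (r δ : ℝ) (S L : Matrix (Fin d) (Fin d) ℝ)
    (ζ ν φ φdot : Proc T Ω d) (t : Period T) (ω : Ω) : ℝ :=
  Real.exp (-r * (t : ℝ)) *
    (φ t ω ⬝ᵥ ν t ω
      - 1 / (2 * δ) * ((φ t ω + ζ t ω) ⬝ᵥ (S *ᵥ (φ t ω + ζ t ω)))
      - φdot t ω ⬝ᵥ (L *ᵥ φdot t ω))

/-- The frictional objective functional under the return process `ν`. -/
def frObjective {T : ℝ} {Ω : Type*} {mΩ : MeasurableSpace Ω} {d : ℕ} (P : Measure Ω)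
    (r δ : ℝ) (S L : Matrix (Fin d) (Fin d) ℝ) (ζ ν φ φdot : Proc T Ω d) : ℝ :=
  expectedIntegral P (frIntegrand r δ S L ζ ν φ φdot)

/-- The aggregate exposure `ζ_{-n}` of the investors other than `n`. -/
def restExposure {T : ℝ} {Ω : Type*} {d N : ℕ} (ζ : Fin N → Proc T Ω d) (n : Fin N) :
    Proc T Ω d :=
  fun t ω => ∑ m ∈ Finset.univ.erase n, ζ m t ω

/-- The part of the returns that does not involve the trading rate of investor `n`:
`Σ (ζ_{-n} - φ - ψ) / (δ (N - 1)) + 2 Λ / (N - 1) (a^ψ̇ - r ψ̇)`. -/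
def impactLinearPart {T : ℝ} {Ω : Type*} {d N : ℕ} (r δ : ℝ) (S L : Matrix (Fin d) (Fin d) ℝ)
    (ζ : Fin N → Proc T Ω d) (n : Fin N) (φ ψ ψdot aψ : Proc T Ω d) : Proc T Ω d :=
  fun t ω =>
    (1 / (δ * ((N : ℝ) - 1))) • (S *ᵥ (restExposure ζ n t ω - φ t ω - ψ t ω))
      + ((2 / ((N : ℝ) - 1)) • L) *ᵥ (aψ t ω - r • ψdot t ω)

/-- The price-impact process of investor `n`:
`2 Λ / (N - 1) (a^φ̇ - r φ̇) + Σ (ζ_{-n} - φ - ψ) / (δ (N - 1)) + 2 Λ / (N - 1) (a^ψ̇ - r ψ̇)`. -/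
def impactReturn {T : ℝ} {Ω : Type*} {d N : ℕ} (r δ : ℝ) (S L : Matrix (Fin d) (Fin d) ℝ)
    (ζ : Fin N → Proc T Ω d) (n : Fin N) (φ φdot aφ ψ ψdot aψ : Proc T Ω d) : Proc T Ω d :=
  fun t ω =>
    ((2 / ((N : ℝ) - 1)) • L) *ᵥ (aφ t ω - r • φdot t ω)
      + impactLinearPart r δ S L ζ n φ ψ ψdot aψ t ω

/-- The integrand of the price-impact-adjusted objective:
`e^{-rt} (φ' (Σ (ζ_{-n} - φ - ψ) / (δ (N - 1)) + 2 Λ / (N - 1) (a^ψ̇ - r ψ̇))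
  - (2δ)⁻¹ (φ + ζ_n)' Σ (φ + ζ_n) - φ̇' (Λ + 2 Λ / (N - 1)) φ̇)`. -/
def adjustedIntegrand {T : ℝ} {Ω : Type*} {d N : ℕ} (r δ : ℝ) (S L : Matrix (Fin d) (Fin d) ℝ)
    (ζ : Fin N → Proc T Ω d) (n : Fin N) (φ φdot ψ ψdot aψ : Proc T Ω d)
    (t : Period T) (ω : Ω) : ℝ :=
  Real.exp (-r * (t : ℝ)) *
    (φ t ω ⬝ᵥ impactLinearPart r δ S L ζ n φ ψ ψdot aψ t ω
      - 1 / (2 * δ) * ((φ t ω + ζ n t ω) ⬝ᵥ (S *ᵥ (φ t ω + ζ n t ω)))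
      - φdot t ω ⬝ᵥ ((L + (2 / ((N : ℝ) - 1)) • L) *ᵥ φdot t ω))

/-- The price-impact-adjusted objective functional of investor `n`. -/
def adjustedObjective {T : ℝ} {Ω : Type*} {mΩ : MeasurableSpace Ω} {d N : ℕ} (P : Measure Ω)
    (r δ : ℝ) (S L : Matrix (Fin d) (Fin d) ℝ)
    (ζ : Fin N → Proc T Ω d) (n : Fin N) (φ φdot ψ ψdot aψ : Proc T Ω d) : ℝ :=
  expectedIntegral P (adjustedIntegrand r δ S L ζ n φ φdot ψ ψdot aψ)

end PriceImpact

end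

open PriceImpact

/-! Let x = φ̇ + ∑_{m ≠ n} φ̇_m + ψ̇ be the aggregate trading rate and X its primitive. Adding the N
- 1 competitive equations to the dynamics of φ̇ and ψ̇ gives dx = b dt + dM, x(T) = 0, with L b = (N
- 1)/2 (ν_n - ν) + S X / (2δ) + r L x (`mulVec_aggregate_drift`). If the market clears, x and X
vanish, so the remaining drift, a multiple of L⁻¹ (ν_n - ν), must vanish too
(`Driven.drift_eq_zero`). If ν = ν_n, then x solves a homogeneous linear forward-backward system,
whose only solution is zero (`eq_zero_of_driven_homogeneous`).

No stochastic integral is needed. Written backwards from T, x(t) = -∫_t^T b ds - (M(T) - M(t)).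
After multiplication by an adapted h, the martingale increment has zero expectation at each fixed
time, and Fubini yields E∫ h x dt = -E∫ (∫_0^t h) b dt (`Driven.integral_mul_eq_neg_primitive`).
Testing with h = x gives the energy identity ∑ L_ii E∫ x_i² + E∫ X'SX / (2δ) + (r/2) ∑ L_ii E
X_i(T)² = 0, a sum of nonnegative terms. Testing the zero process with its own drift and then with
the primitive of that drift kills the drift. Exponentially weighted tests give E∫ e^{-rt} (φ'L(a -
rφ̇) + φ̇'Lφ̇) dt = 0 (`Driven.integral_exp_mul`); 2/(N - 1) times this is the difference of the two
objectives.

The tests must be adapted although the filtration is neither complete nor right-continuous;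
`measurable_stopping_optionalSigma` supplies this. -/

noncomputable section

namespace PriceImpact

/-! ### Lebesgue measure on the trading period -/

section Lebesgue

variable {T : ℝ}

lemma measurePreserving_coe_leb (T : ℝ) :
    MeasurePreserving ((↑) : Period T → ℝ) (leb T) (volume.restrict (Set.Icc 0 T)) :=
  measurePreserving_subtype_coe measurableSet_Icc

instance isFiniteMeasure_leb : IsFiniteMeasure (leb T) where
  measure_univ_lt_top := by
    have h := (measurePreserving_coe_leb T).measure_preimage (MeasurableSet.univ).nullMeasurableSet
    rw [Set.preimage_univ] at h
    rw [h]
    exact measure_lt_top _ _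

instance nullSingletonClass_leb : NullSingletonClass (leb T) where
  measure_singleton t := by
    have h := (measurePreserving_coe_leb T).measure_preimage
      (measurableSet_singleton (t : ℝ)).nullMeasurableSet
    rw [measure_singleton] at h
    refine measure_mono_null ?_ h
    rintro _ rfl
    rfl

/-- The open interval is dense in `[0, T]` when `T > 0`. This upgrades almost everywhere equality of
continuous paths to equality at all times. -/
lemma isOpenPosMeasure_leb (hT : 0 < T) : (leb T).IsOpenPosMeasure where
  open_pos U hU hne := by
    obtain ⟨V, hV, rfl⟩ := isOpen_induced_iff.1 hU
    rw [(measurePreserving_coe_leb T).measure_preimage hV.measurableSet.nullMeasurableSet,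
      Measure.restrict_apply hV.measurableSet]
    obtain ⟨t, ht⟩ := hne
    have hcl : (t : ℝ) ∈ closure (Set.Ioo 0 T) := by
      rw [closure_Ioo hT.ne]
      exact t.2
    obtain ⟨s, hsV, hs⟩ := mem_closure_iff.1 hcl V hV ht
    have hpos : 0 < volume (V ∩ Set.Ioo 0 T) :=
      (hV.inter isOpen_Ioo).measure_pos _ ⟨s, hsV, hs⟩
    exact (hpos.trans_le (measure_mono
      (Set.inter_subset_inter_right _ Set.Ioo_subset_Icc_self))).ne'

/-- The end of the trading period. -/
def horizon (hT : 0 < T) : Period T := ⟨T, hT.le, le_rfl⟩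

lemma isTop_horizon (hT : 0 < T) : IsTop (horizon hT) := fun t => t.2.2

end Lebesgue

/-! ### Optional processes, adaptedness and primitives -/

section Progressive

variable {T : ℝ} {Ω : Type*} {mΩ : MeasurableSpace Ω} {ℱ : Filtration (Period T) mΩ}

/-- The grid point `min (k / n) t` of `[0, T]`. -/
def gridPoint (t : Period T) (n k : ℕ) : Period T :=
  ⟨min ((k : ℝ) / (n + 1)) t, le_min (by positivity) t.2.1, (min_le_right _ _).trans t.2.2⟩

lemma gridPoint_le (t : Period T) (n k : ℕ) : gridPoint t n k ≤ t :=
  Subtype.coe_le_coe.1 (min_le_right _ _)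

lemma min_le_gridPoint (t s : Period T) (n : ℕ) :
    min s t ≤ gridPoint t n ⌈((n : ℝ) + 1) * s⌉₊ := by
  have h : (s : ℝ) ≤ (⌈((n : ℝ) + 1) * s⌉₊ : ℝ) / (n + 1) := by
    rw [le_div_iff₀ (by positivity), mul_comm]
    exact Nat.le_ceil _
  rw [← Subtype.coe_le_coe]
  have h2 : ((min s t : Period T) : ℝ) = min (s : ℝ) t := by
    rcases le_total s t with h | h
    · rw [min_eq_left h, min_eq_left (Subtype.coe_le_coe.2 h)]
    · rw [min_eq_right h, min_eq_right (Subtype.coe_le_coe.2 h)]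
  rw [h2]
  exact min_le_min_right _ h

/-- The grid points approach `min s t` from the right, so right-continuity of paths suffices, and
never exceed `t`, so no later information enters. -/
lemma tendsto_gridPoint (t s : Period T) :
    Tendsto (fun n : ℕ => gridPoint t n ⌈((n : ℝ) + 1) * s⌉₊) atTop (𝓝[≥] (min s t)) := by
  refine tendsto_nhdsWithin_iff.2 ⟨?_, Eventually.of_forall fun n => min_le_gridPoint t s n⟩
  rw [tendsto_subtype_rng]
  have h2 : ((min s t : Period T) : ℝ) = min (s : ℝ) t := by
    rcases le_total s t with h | h
    · rw [min_eq_left h, min_eq_left (Subtype.coe_le_coe.2 h)]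
    · rw [min_eq_right h, min_eq_right (Subtype.coe_le_coe.2 h)]
  rw [h2]
  refine Tendsto.min ?_ tendsto_const_nhds
  have h1 := (tendsto_nat_ceil_mul_div_atTop (R := ℝ) (a := (s : ℝ)) s.2.1).comp
    ((tendsto_natCast_atTop_atTop (R := ℝ)).atTop_add tendsto_const_nhds (C := 1))
  refine h1.congr fun n => ?_
  simp [mul_comm]

/-- A right-continuous adapted process stopped at `t` is jointly measurable with respect to the
information available at `t`. -/
lemma measurable_stopped_of_rightContinuous {Y : Period T → Ω → ℝ} (hY : StronglyAdapted ℱ Y)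
    (hc : ∀ ω t, ContinuousWithinAt (fun s => Y s ω) (Set.Ici t) t) (t : Period T) :
    Measurable[(inferInstance : MeasurableSpace (Period T)).prod (ℱ t)]
      (fun p : Period T × Ω => Y (min p.1 t) p.2) := by
  let : MeasurableSpace Ω := ℱ t
  have happ : ∀ n : ℕ, Measurable (fun p : Period T × Ω =>
      Y (gridPoint t n ⌈((n : ℝ) + 1) * p.1⌉₊) p.2) := by
    intro n
    -- For fixed `n` time enters only through a natural number, so joint measurability may be
    -- checked index by index.
    have h1 : Measurable (fun q : ℕ × Ω => Y (gridPoint t n q.1) q.2) :=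
      measurable_from_prod_countable_right fun k =>
        ((hY (gridPoint t n k)).mono (ℱ.mono (gridPoint_le t n k))).measurable
    have h2 : Measurable (fun p : Period T × Ω => (⌈((n : ℝ) + 1) * p.1⌉₊, p.2)) := by
      refine Measurable.prodMk (Nat.measurable_ceil.comp ?_) measurable_snd
      exact (measurable_subtype_coe.comp measurable_fst).const_mul _
    exact h1.comp h2
  refine measurable_of_tendsto_metrizable happ (tendsto_pi_nhds.2 fun p => ?_)
  exact (hc p.2 (min p.1 t)).tendsto.comp (tendsto_gridPoint t p.1)

/-- Pulling back a generator of the optional σ-algebra gives a stopped right-continuous adapted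
process. Adaptedness of optional processes and of their primitives follows from this. -/
lemma measurable_stopping_optionalSigma (ℱ : Filtration (Period T) mΩ) (t : Period T) :
    Measurable[(inferInstance : MeasurableSpace (Period T)).prod (ℱ t), optionalSigma ℱ]
      (fun p : Period T × Ω => (min p.1 t, p.2)) := by
  rw [measurable_iff_comap_le, optionalSigma, MeasurableSpace.comap_iSup]
  refine iSup_le fun Y => ?_
  rw [MeasurableSpace.comap_iSup]
  refine iSup_le fun hY => ?_
  rw [MeasurableSpace.comap_comp]
  exact (measurable_stopped_of_rightContinuous hY.1 hY.2.1 t).comap_le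

lemma measurable_section_optionalSigma (ℱ : Filtration (Period T) mΩ) (t : Period T) :
    Measurable[ℱ t, optionalSigma ℱ] (fun ω : Ω => (t, ω)) := by
  let : MeasurableSpace Ω := ℱ t
  have h := (measurable_stopping_optionalSigma ℱ t).comp (measurable_prodMk_left (x := t))
  simpa [Function.comp_def] using h

/-- Stopping at the horizon is the identity. -/
lemma optionalSigma_le (hT : 0 < T) (ℱ : Filtration (Period T) mΩ) :
    optionalSigma ℱ ≤ Prod.instMeasurableSpace := by
  have h := (measurable_stopping_optionalSigma ℱ (horizon hT)).comap_le
  have h2 : (fun p : Period T × Ω => (min p.1 (horizon hT), p.2)) = id := by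
    funext p
    rw [min_eq_left (isTop_horizon hT p.1)]
    rfl
  rw [h2, MeasurableSpace.comap_id] at h
  refine h.trans (sup_le_sup le_rfl ?_)
  exact MeasurableSpace.comap_mono (ℱ.le _)

/-- Continuous adapted processes are optional. -/
lemma measurable_optionalSigma_of_continuous {Y : Period T → Ω → ℝ} (hY : StronglyAdapted ℱ Y)
    (hc : ∀ ω, Continuous (fun s => Y s ω)) :
    Measurable[optionalSigma ℱ] (fun p : Period T × Ω => Y p.1 p.2) := by
  rw [measurable_iff_comap_le]
  refine le_iSup₂_of_le Y ⟨hY, fun ω t => (hc ω).continuousWithinAt, fun ω t => ⟨Y t ω, ?_⟩⟩ le_rfl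
  exact ((hc ω).tendsto t).mono_left nhdsWithin_le_nhds

/-- The primitive `∫₀ᵗ f(s) ds` of a scalar process. -/
def primitive (f : Period T → Ω → ℝ) (t : Period T) (ω : Ω) : ℝ :=
  ∫ s in Set.Iic t, f s ω ∂(leb T)

/-- Up to time `t` the integrand agrees with its stopped version, which is jointly measurable for `ℱ
t`; integrating out time preserves this. -/
lemma stronglyAdapted_primitive {f : Period T → Ω → ℝ}
    (hf : Measurable[optionalSigma ℱ] (fun p : Period T × Ω => f p.1 p.2)) :
    StronglyAdapted ℱ (primitive f) := by
  intro t
  have h := hf.comp (measurable_stopping_optionalSigma ℱ t)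
  have h2 : primitive f t = fun ω => ∫ s in Set.Iic t, f (min s t) ω ∂(leb T) := by
    funext ω
    refine setIntegral_congr_fun measurableSet_Iic fun s hs => ?_
    rw [min_eq_left hs]
  rw [h2]
  let : MeasurableSpace Ω := ℱ t
  exact (h.stronglyMeasurable).integral_prod_left'

lemma stronglyAdapted_of_optional {f : Period T → Ω → ℝ}
    (hf : Measurable[optionalSigma ℱ] (fun p : Period T × Ω => f p.1 p.2)) :
    StronglyAdapted ℱ f := fun t =>
  (hf.comp (measurable_section_optionalSigma ℱ t)).stronglyMeasurable

lemma continuous_setIntegral_Iic {f : Period T → ℝ} (hf : Integrable f (leb T)) :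
    Continuous (fun t : Period T => ∫ s in Set.Iic t, f s ∂(leb T)) := by
  simp_rw [← integral_indicator measurableSet_Iic]
  refine continuous_iff_continuousAt.2 fun t => ?_
  refine tendsto_integral_filter_of_dominated_convergence (fun s => ‖f s‖) ?_ ?_ hf.norm ?_
  · exact Eventually.of_forall fun u => hf.1.indicator measurableSet_Iic
  · exact Eventually.of_forall fun u => Eventually.of_forall fun s => norm_indicator_le_norm_self _ _
  · have hne : ∀ᵐ s ∂(leb T), s ≠ t := by
      simp [ae_iff]
    filter_upwards [hne] with s hs
    rcases lt_or_gt_of_ne hs with h | h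
    · refine tendsto_const_nhds.congr' ?_
      filter_upwards [lt_mem_nhds h] with u hu
      rw [Set.indicator_of_mem (Set.mem_Iic.2 h.le), Set.indicator_of_mem (Set.mem_Iic.2 hu.le)]
    · refine tendsto_const_nhds.congr' ?_
      filter_upwards [gt_mem_nhds h] with u hu
      rw [Set.indicator_of_notMem (by simpa using h), Set.indicator_of_notMem (by simpa using hu)]

end Progressive

/-! ### Deterministic integral identities along a path -/

section Pathwise

variable {T : ℝ} {f g : Period T → ℝ}

lemma setIntegral_Ioi_eq_sub {e : Period T} (he : IsTop e) (hf : Integrable f (leb T))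
    (t : Period T) :
    ∫ s in Set.Ioi t, f s ∂(leb T) =
      (∫ s in Set.Iic e, f s ∂(leb T)) - ∫ s in Set.Iic t, f s ∂(leb T) := by
  have h1 : Set.Iic e = Set.univ := Set.eq_univ_of_forall he
  have h2 := integral_add_compl (measurableSet_Iic (a := t)) hf
  rw [Set.compl_Iic] at h2
  rw [h1, setIntegral_univ]
  linarith

/-- Fubini's theorem on the triangle `{t ≤ u}`. -/
lemma integral_mul_setIntegral_Ioi (hf : Integrable f (leb T)) (hg : Integrable g (leb T)) :
    ∫ t, f t * ∫ u in Set.Ioi t, g u ∂(leb T) ∂(leb T) =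
      ∫ u, (∫ t in Set.Iic u, f t ∂(leb T)) * g u ∂(leb T) := by
  have hS : MeasurableSet {p : Period T × Period T | p.1 < p.2} :=
    measurableSet_lt measurable_fst measurable_snd
  have hint := (hf.mul_prod hg).indicator hS
  have h := integral_integral_swap (f := fun t u =>
    Set.indicator {p : Period T × Period T | p.1 < p.2} (fun p => f p.1 * g p.2) (t, u)) hint
  have h1 : ∀ t u : Period T, Set.indicator {p : Period T × Period T | p.1 < p.2}
      (fun p => f p.1 * g p.2) (t, u) = f t * (Set.Ioi t).indicator g u := by
    intro t u
    by_cases htu : t < u <;> simp [htu]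
  have h2 : ∀ t u : Period T, Set.indicator {p : Period T × Period T | p.1 < p.2}
      (fun p => f p.1 * g p.2) (t, u) = (Set.Iio u).indicator f t * g u := by
    intro t u
    by_cases htu : t < u <;> simp [htu]
  have h3 : ∀ t : Period T, ∫ u, Set.indicator {p : Period T × Period T | p.1 < p.2}
      (fun p => f p.1 * g p.2) (t, u) ∂(leb T) = f t * ∫ u in Set.Ioi t, g u ∂(leb T) := by
    intro t
    simp_rw [h1]
    rw [integral_const_mul, integral_indicator measurableSet_Ioi]
  have h4 : ∀ u : Period T, ∫ t, Set.indicator {p : Period T × Period T | p.1 < p.2}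
      (fun p => f p.1 * g p.2) (t, u) ∂(leb T) = (∫ t in Set.Iic u, f t ∂(leb T)) * g u := by
    intro u
    simp_rw [h2]
    rw [integral_mul_const, integral_indicator measurableSet_Iio, integral_Iic_eq_integral_Iio]
  simp_rw [h3, h4] at h
  exact h

/-- With F the primitive of f, Fubini on the triangle gives ∫ f (F(e) - F) = ∫ F f, which is the
chain rule for F² without differentiability. -/
lemma integral_setIntegral_Iic_mul_self {e : Period T} (he : IsTop e)
    (hf : Integrable f (leb T)) :
    ∫ u, (∫ t in Set.Iic u, f t ∂(leb T)) * f u ∂(leb T) =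
      (∫ t in Set.Iic e, f t ∂(leb T)) ^ 2 / 2 := by
  have h := integral_mul_setIntegral_Ioi hf hf
  simp_rw [setIntegral_Ioi_eq_sub he hf, mul_sub] at h
  have hc := continuous_setIntegral_Iic hf
  have hbi : Integrable (fun t => f t * ∫ s in Set.Iic t, f s ∂(leb T)) (leb T) := by
    refine hf.mul_bdd (c := ∫ s, ‖f s‖ ∂(leb T)) hc.aestronglyMeasurable
      (Eventually.of_forall fun t => ?_)
    exact (norm_integral_le_integral_norm _).trans
      (setIntegral_le_integral hf.norm (Eventually.of_forall fun _ => norm_nonneg _))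
  rw [integral_sub (hf.mul_const _) hbi, integral_mul_const] at h
  have h1 : ∫ t, f t ∂(leb T) = ∫ t in Set.Iic e, f t ∂(leb T) := by
    rw [Set.eq_univ_of_forall (s := Set.Iic e) he, setIntegral_univ]
  have h2 : ∫ t, f t * ∫ s in Set.Iic t, f s ∂(leb T) ∂(leb T) =
      ∫ u, (∫ t in Set.Iic u, f t ∂(leb T)) * f u ∂(leb T) := by simp_rw [mul_comm]
  rw [h1, h2] at h
  linarith [sq (∫ t in Set.Iic e, f t ∂(leb T))]

/-- A function on `[0, T]` with vanishing primitive vanishes. -/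
lemma ae_eq_zero_of_setIntegral_Iic_eq_zero (hf : Integrable f (leb T))
    (h : ∀ t, ∫ s in Set.Iic t, f s ∂(leb T) = 0) : f =ᵐ[leb T] 0 := by
  have key : ∀ t : Period T, ∫⁻ s in Set.Iic t, ENNReal.ofReal (f s) ∂(leb T) =
      ∫⁻ s in Set.Iic t, ENNReal.ofReal (-f s) ∂(leb T) := by
    intro t
    have h1 := integral_eq_lintegral_pos_part_sub_lintegral_neg_part (hf.restrict (s := Set.Iic t))
    rw [h t, eq_comm, sub_eq_zero] at h1
    refine (ENNReal.toReal_eq_toReal_iff' ?_ ?_).1 h1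
    · exact (hf.restrict (s := Set.Iic t)).lintegral_lt_top.ne
    · exact (hf.neg.restrict (s := Set.Iic t)).lintegral_lt_top.ne
  have hfin : IsFiniteMeasure ((leb T).withDensity fun s => ENNReal.ofReal (f s)) :=
    isFiniteMeasure_withDensity_ofReal hf.2
  -- The positive and negative parts define finite measures agreeing on all initial segments, hence
  -- equal.
  have heq : (leb T).withDensity (fun s => ENNReal.ofReal (f s)) =
      (leb T).withDensity (fun s => ENNReal.ofReal (-f s)) := by
    refine Measure.ext_of_Iic _ _ fun t => ?_
    rw [withDensity_apply _ measurableSet_Iic, withDensity_apply _ measurableSet_Iic, key]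
  have hae := (withDensity_eq_iff hf.1.aemeasurable.ennreal_ofReal
    hf.1.aemeasurable.neg.ennreal_ofReal hf.lintegral_lt_top.ne).1 heq
  filter_upwards [hae] with s hs
  rw [Pi.neg_apply] at hs
  rcases le_total (f s) 0 with h0 | h0
  · rw [ENNReal.ofReal_of_nonpos h0, eq_comm, ENNReal.ofReal_eq_zero] at hs
    simp only [Pi.zero_apply]
    linarith
  · rw [ENNReal.ofReal_of_nonpos (p := -f s) (by linarith), ENNReal.ofReal_eq_zero] at hs
    simp only [Pi.zero_apply]
    linarith

/-- Cauchy–Schwarz: the quadratic m ↦ ∫ (|f| - m)² is nonnegative, so its discriminant is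
nonpositive. -/
lemma sq_integral_le (hf : MemLp f 2 (leb T)) :
    (∫ s, |f s| ∂(leb T)) ^ 2 ≤ (leb T).real Set.univ * ∫ s, f s ^ 2 ∂(leb T) := by
  have hi : Integrable f (leb T) := hf.integrable one_le_two
  have hd := discrim_le_zero (a := (leb T).real Set.univ) (b := -2 * ∫ s, |f s| ∂(leb T))
    (c := ∫ s, f s ^ 2 ∂(leb T)) fun m => by
      have h0 : 0 ≤ ∫ s, (m * m + (-2 * m) * |f s| + f s ^ 2) ∂(leb T) := by
        refine integral_nonneg fun s => ?_
        have h := sq_nonneg (|f s| - m)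
        rw [sub_sq, sq_abs] at h
        simp only [Pi.zero_apply]
        linarith
      have h1 : Integrable (fun s => m * m + (-2 * m) * |f s|) (leb T) :=
        (integrable_const _).add (hi.abs.const_mul _)
      rw [integral_add h1 hf.integrable_sq,
        integral_add (integrable_const _) (hi.abs.const_mul _), integral_const,
        integral_const_mul, smul_eq_mul] at h0
      linarith
  rw [discrim] at hd
  linarith

end Pathwise

/-! ### Square integrable scalar processes -/

section Square

variable {T : ℝ} {Ω : Type*} {mΩ : MeasurableSpace Ω} {P : Measure Ω}

/-- Square integrability of a scalar process on `[0, T] × Ω`. -/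
def SqIntegrable (P : Measure Ω) (f : Period T → Ω → ℝ) : Prop :=
  MemLp (fun p : Period T × Ω => f p.1 p.2) 2 ((leb T).prod P)

variable {f g : Period T → Ω → ℝ}

lemma ae_ae_of_ae_prod_leb [SFinite P] {p : Period T → Ω → Prop}
    (h : ∀ᵐ q ∂((leb T).prod P), p q.1 q.2) : ∀ᵐ ω ∂P, ∀ᵐ t ∂(leb T), p t ω := by
  have h2 : ∀ᵐ q ∂(P.prod (leb T)), p q.2 q.1 :=
    (Measure.measurePreserving_swap (μ := P) (ν := leb T)).quasiMeasurePreserving.ae h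
  exact Measure.ae_ae_of_ae_prod h2

lemma SqIntegrable.memLp_path [SFinite P] (hf : SqIntegrable P f) :
    ∀ᵐ ω ∂P, MemLp (fun t => f t ω) 2 (leb T) := by
  have h1 := hf.integrable_sq.prod_left_ae
  have h2 : ∀ᵐ ω ∂P, AEStronglyMeasurable (fun t => f t ω) (leb T) :=
    AEStronglyMeasurable.prodMk_right hf.1
  filter_upwards [h1, h2] with ω hω hm
  exact (memLp_two_iff_integrable_sq hm).2 hω

lemma SqIntegrable.memLp_section [SFinite P] (hf : SqIntegrable P f) :
    ∀ᵐ t ∂(leb T), MemLp (f t) 2 P := by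
  have h1 := hf.integrable_sq.prod_right_ae
  have h2 : ∀ᵐ t ∂(leb T), AEStronglyMeasurable (f t) P :=
    AEStronglyMeasurable.prodMk_left hf.1
  filter_upwards [h1, h2] with t ht hm
  exact (memLp_two_iff_integrable_sq hm).2 ht

lemma SqIntegrable.integrable_path [SFinite P] (hf : SqIntegrable P f) :
    ∀ᵐ ω ∂P, Integrable (fun t => f t ω) (leb T) :=
  hf.memLp_path.mono fun _ h => h.integrable one_le_two

lemma SqIntegrable.integrable_mul (hf : SqIntegrable P f) (hg : SqIntegrable P g) :
    Integrable (fun p : Period T × Ω => f p.1 p.2 * g p.1 p.2) ((leb T).prod P) :=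
  MemLp.integrable_mul hf hg

/-- Pathwise Cauchy–Schwarz bounds the square of the integral by a time-independent integrable
variable. Indicator kernels yield `primitive` and `tail`. -/
lemma SqIntegrable.kernel [IsFiniteMeasure P] (hf : SqIntegrable P f)
    {k : Period T × Period T → ℝ} (hk : Measurable k) (hk1 : ∀ q, |k q| ≤ 1) :
    SqIntegrable P (fun t ω => ∫ s, k (t, s) * f s ω ∂(leb T)) := by
  have hqmp : Measure.QuasiMeasurePreserving
      (fun q : (Period T × Ω) × Period T => (q.2, q.1.2))
      (((leb T).prod P).prod (leb T)) ((leb T).prod P) := by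
    have h1 := (Measure.measurePreserving_swap (μ := (leb T).prod P)
      (ν := leb T)).quasiMeasurePreserving
    have h2 : Measure.QuasiMeasurePreserving (Prod.map id Prod.snd :
        Period T × (Period T × Ω) → Period T × Ω) ((leb T).prod ((leb T).prod P))
        ((leb T).prod P) :=
      MeasureTheory.QuasiMeasurePreserving.prodMap (Measure.QuasiMeasurePreserving.id _)
        Measure.quasiMeasurePreserving_snd
    exact h2.comp h1
  have hm : AEStronglyMeasurable (fun q : (Period T × Ω) × Period T =>
      k (q.1.1, q.2) * f q.2 q.1.2) (((leb T).prod P).prod (leb T)) := by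
    refine AEStronglyMeasurable.mul ?_ (hf.1.comp_quasiMeasurePreserving hqmp)
    exact (hk.comp ((measurable_fst.comp measurable_fst).prodMk
      measurable_snd)).aestronglyMeasurable
  have hm2 := hm.integral_prod_right'
  refine (memLp_two_iff_integrable_sq hm2).2 ?_
  have hdom : Integrable (fun p : Period T × Ω =>
      (leb T).real Set.univ * ∫ s, f s p.2 ^ 2 ∂(leb T)) ((leb T).prod P) := by
    have h1 : Integrable (fun ω => ∫ s, f s ω ^ 2 ∂(leb T)) P :=
      hf.integrable_sq.integral_prod_right
    exact (h1.comp_snd (leb T)).const_mul _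
  refine hdom.mono' (hm2.pow 2) ?_
  have hp : ∀ᵐ p ∂((leb T).prod P), MemLp (fun t => f t p.2) 2 (leb T) :=
    Measure.quasiMeasurePreserving_snd.ae hf.memLp_path
  filter_upwards [hp] with p hp
  have hi : Integrable (fun s => f s p.2) (leb T) := hp.integrable one_le_two
  refine le_trans ?_ (sq_integral_le hp)
  rw [Real.norm_eq_abs, abs_pow]
  refine pow_le_pow_left₀ (abs_nonneg _) ?_ 2
  refine (abs_integral_le_integral_abs).trans ?_
  refine integral_mono_of_nonneg (Eventually.of_forall fun s => abs_nonneg _) hi.abs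
    (Eventually.of_forall fun s => ?_)
  simp only [abs_mul]
  exact mul_le_of_le_one_left (abs_nonneg _) (hk1 _)

/-- The integral `∫ₜᵀ f(s) ds` of a scalar process. -/
def tail (f : Period T → Ω → ℝ) (t : Period T) (ω : Ω) : ℝ :=
  ∫ s in Set.Ioi t, f s ω ∂(leb T)

lemma SqIntegrable.primitive [IsFiniteMeasure P] (hf : SqIntegrable P f) :
    SqIntegrable P (primitive f) := by
  have h := hf.kernel (k := {q : Period T × Period T | q.2 ≤ q.1}.indicator 1)
    (measurable_one.indicator (measurableSet_le measurable_snd measurable_fst)) fun q => by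
      by_cases hq : q.2 ≤ q.1 <;> simp [hq]
  convert h using 3 with t ω
  rw [PriceImpact.primitive, ← integral_indicator measurableSet_Iic]
  refine integral_congr_ae (Eventually.of_forall fun s => ?_)
  by_cases hs : s ≤ t <;> simp [hs]

lemma SqIntegrable.tail [IsFiniteMeasure P] (hf : SqIntegrable P f) :
    SqIntegrable P (tail f) := by
  have h := hf.kernel (k := {q : Period T × Period T | q.1 < q.2}.indicator 1)
    (measurable_one.indicator (measurableSet_lt measurable_fst measurable_snd)) fun q => by
      by_cases hq : q.1 < q.2 <;> simp [hq]
  convert h using 3 with t ω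
  rw [PriceImpact.tail, ← integral_indicator measurableSet_Ioi]
  refine integral_congr_ae (Eventually.of_forall fun s => ?_)
  by_cases hs : t < s <;> simp [hs]

lemma SqIntegrable.add (hf : SqIntegrable P f) (hg : SqIntegrable P g) :
    SqIntegrable P (fun t ω => f t ω + g t ω) := MemLp.add hf hg

lemma SqIntegrable.const_mul (c : ℝ) (hf : SqIntegrable P f) :
    SqIntegrable P (fun t ω => c * f t ω) := MemLp.const_mul hf c

lemma SqIntegrable.sum {ι : Type*} (s : Finset ι) {F : ι → Period T → Ω → ℝ}
    (hF : ∀ i ∈ s, SqIntegrable P (F i)) : SqIntegrable P (fun t ω => ∑ i ∈ s, F i t ω) :=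
  memLp_finsetSum s hF

lemma SqIntegrable.congr (hf : SqIntegrable P f)
    (h : ∀ᵐ p ∂((leb T).prod P), f p.1 p.2 = g p.1 p.2) : SqIntegrable P g :=
  MemLp.ae_eq h hf

/-- `primitive` and `tail` are adjoint in L², by Fubini on the triangle along each path. -/
lemma integral_mul_tail [IsFiniteMeasure P] (hf : SqIntegrable P f) (hg : SqIntegrable P g) :
    ∫ p, f p.1 p.2 * tail g p.1 p.2 ∂((leb T).prod P) =
      ∫ p, primitive f p.1 p.2 * g p.1 p.2 ∂((leb T).prod P) := by
  rw [integral_prod_symm _ (hf.integrable_mul hg.tail),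
    integral_prod_symm _ (hf.primitive.integrable_mul hg)]
  refine integral_congr_ae ?_
  filter_upwards [hf.integrable_path, hg.integrable_path] with ω h1 h2
  exact integral_mul_setIntegral_Ioi h1 h2

end Square

/-! ### Discounting -/

section Exponential

variable {T : ℝ}

lemma setIntegral_Ioc_exp (r : ℝ) {t u : Period T} (htu : t ≤ u) :
    ∫ s in Set.Ioc t u, r * Real.exp (-r * (s : ℝ)) ∂(leb T) =
      Real.exp (-r * (t : ℝ)) - Real.exp (-r * (u : ℝ)) := by
  have hpre : Set.Ioc t u = ((↑) : Period T → ℝ) ⁻¹' Set.Ioc (t : ℝ) u := rfl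
  rw [hpre, (measurePreserving_coe_leb T).setIntegral_preimage_emb
    (MeasurableEmbedding.subtype_coe measurableSet_Icc)
    (fun s : ℝ => r * Real.exp (-r * s)), Measure.restrict_restrict measurableSet_Ioc]
  have hsub : Set.Ioc (t : ℝ) u ∩ Set.Icc 0 T = Set.Ioc (t : ℝ) u :=
    Set.inter_eq_left.2 fun s hs => ⟨t.2.1.trans hs.1.le, hs.2.trans u.2.2⟩
  rw [hsub, ← intervalIntegral.integral_of_le (Subtype.coe_le_coe.2 htu)]
  have hd : ∀ s ∈ Set.uIcc (t : ℝ) u,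
      HasDerivAt (fun s : ℝ => -Real.exp (-r * s)) (r * Real.exp (-r * s)) s := by
    intro s _
    have h := (((hasDerivAt_id s).const_mul (-r)).exp).neg
    refine h.congr_deriv ?_
    simp [mul_comm]
  rw [intervalIntegral.integral_eq_sub_of_hasDerivAt hd
    (Continuous.intervalIntegrable (by fun_prop) _ _)]
  ring

lemma integrable_exp_leb (r : ℝ) :
    Integrable (fun s : Period T => Real.exp (-r * (s : ℝ))) (leb T) := by
  refine (integrable_const (Real.exp (|r| * T))).mono' ?_ (Eventually.of_forall fun s => ?_)
  · exact (by fun_prop : Continuous fun s : Period T =>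
      Real.exp (-r * (s : ℝ))).aestronglyMeasurable
  · rw [Real.norm_eq_abs, Real.abs_exp, Real.exp_le_exp]
    calc -r * (s : ℝ) ≤ |r| * s := mul_le_mul_of_nonneg_right (neg_le_abs r) s.2.1
      _ ≤ |r| * T := mul_le_mul_of_nonneg_left s.2.2 (abs_nonneg r)

/-- Integration by parts against an exponential weight. -/
lemma setIntegral_Iic_exp_mul (r : ℝ) {f : Period T → ℝ} (hf : Integrable f (leb T))
    (u : Period T) :
    ∫ t in Set.Iic u, Real.exp (-r * (t : ℝ)) * f t ∂(leb T) =
      Real.exp (-r * (u : ℝ)) * (∫ t in Set.Iic u, f t ∂(leb T)) +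
      ∫ t in Set.Iic u, r * Real.exp (-r * (t : ℝ)) * (∫ s in Set.Iic t, f s ∂(leb T))
        ∂(leb T) := by
  -- Fubini on the triangle applies with this truncated weight because its tail from `t ≤ u` is
  -- e^{-rt} - e^{-ru}.
  have hg : Integrable ((Set.Iic u).indicator fun s : Period T => r * Real.exp (-r * (s : ℝ)))
      (leb T) := ((integrable_exp_leb r).const_mul r).indicator measurableSet_Iic
  have h := integral_mul_setIntegral_Ioi (hf.indicator (measurableSet_Iic (a := u))) hg
  have h1 : ∀ t : Period T, (Set.Iic u).indicator f t *
      ∫ s in Set.Ioi t, (Set.Iic u).indicator (fun s : Period T => r * Real.exp (-r * (s : ℝ))) s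
        ∂(leb T) =
      (Set.Iic u).indicator (fun t : Period T => Real.exp (-r * (t : ℝ)) * f t -
        Real.exp (-r * (u : ℝ)) * f t) t := by
    intro t
    by_cases htu : t ≤ u
    · rw [Set.indicator_of_mem (Set.mem_Iic.2 htu), Set.indicator_of_mem (Set.mem_Iic.2 htu),
        setIntegral_indicator measurableSet_Iic, Set.Ioi_inter_Iic, setIntegral_Ioc_exp r htu]
      ring
    · simp [htu]
  have h2 : ∀ s : Period T, (∫ t in Set.Iic s, (Set.Iic u).indicator f t ∂(leb T)) *
      (Set.Iic u).indicator (fun s : Period T => r * Real.exp (-r * (s : ℝ))) s =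
      (Set.Iic u).indicator (fun t : Period T => r * Real.exp (-r * (t : ℝ)) *
        (∫ s in Set.Iic t, f s ∂(leb T))) s := by
    intro s
    by_cases hsu : s ≤ u
    · rw [Set.indicator_of_mem (Set.mem_Iic.2 hsu), Set.indicator_of_mem (Set.mem_Iic.2 hsu),
        setIntegral_indicator measurableSet_Iic, Set.Iic_inter_Iic, min_eq_left hsu]
      ring
    · simp [hsu]
  simp_rw [h1, h2] at h
  rw [integral_indicator measurableSet_Iic, integral_indicator measurableSet_Iic] at h
  have hef : Integrable (fun t : Period T => Real.exp (-r * (t : ℝ)) * f t) (leb T) := by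
    refine hf.bdd_mul (c := Real.exp (|r| * T)) ?_ (Eventually.of_forall fun s => ?_)
    · exact (by fun_prop : Continuous fun s : Period T =>
        Real.exp (-r * (s : ℝ))).aestronglyMeasurable
    · rw [Real.norm_eq_abs, Real.abs_exp, Real.exp_le_exp]
      calc -r * (s : ℝ) ≤ |r| * s := mul_le_mul_of_nonneg_right (neg_le_abs r) s.2.1
        _ ≤ |r| * T := mul_le_mul_of_nonneg_left s.2.2 (abs_nonneg r)
  rw [integral_sub hef.restrict (hf.restrict.const_mul _), integral_const_mul] at h
  linarith

end Exponential

/-! ### Scalar backward dynamics tested against adapted processes -/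

section Driven

variable {T : ℝ} {Ω : Type*} {mΩ : MeasurableSpace Ω} {ℱ : Filtration (Period T) mΩ}
  {P : Measure Ω} {e : Period T}

/-- The scalar process `x` satisfies `dx = b dt + dM` for a continuous martingale `M`, and vanishes
at the terminal time `e`. -/
def Driven (ℱ : Filtration (Period T) mΩ) (P : Measure Ω) (e : Period T)
    (x b : Period T → Ω → ℝ) : Prop :=
  (∀ᵐ ω ∂P, Integrable (fun t => b t ω) (leb T)) ∧
  ∃ M : Period T → Ω → ℝ, Martingale M ℱ P ∧ (∀ᵐ ω ∂P, Continuous fun t => M t ω) ∧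
    ∀ᵐ ω ∂P, ∀ t, x t ω + tail b t ω + (M e ω - M t ω) = 0

/-- Conditional expectation commutes with coordinate projections, which are continuous linear maps.
-/
lemma martingale_apply {ι : Type*} [Fintype ι] {M : Period T → Ω → ι → ℝ}
    (hM : Martingale M ℱ P) (i : ι) : Martingale (fun t ω => M t ω i) ℱ P := by
  refine ⟨fun t => ?_, fun s t hst => ?_⟩
  · exact (continuous_apply i).comp_stronglyMeasurable (hM.1 t)
  · have h := (ContinuousLinearMap.proj (R := ℝ) (φ := fun _ : ι => ℝ) i).comp_condExp_comm
      (m := ℱ s) (hM.integrable t)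
    refine h.symm.trans ?_
    filter_upwards [hM.2 s t hst] with ω hω
    simp [hω]

variable {x y b c h : Period T → Ω → ℝ}

/-- The dynamics are read between `t` and the horizon, where `X` vanishes. Integrability of every
component is needed to evaluate the vector integral coordinatewise. -/
lemma Driven.of_hasDynamics {d : ℕ} {X B M : Proc T Ω d} (he : (e : ℝ) = T)
    (hX : TerminalZero P X) (hM : Martingale M ℱ P) (hMc : ContinuousPaths P M)
    (hd : HasDynamics P X B M)
    (hB : ∀ i, ∀ᵐ ω ∂P, Integrable (fun t => B t ω i) (leb T)) (i : Fin d) :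
    Driven ℱ P e (fun t ω => X t ω i) (fun t ω => B t ω i) := by
  refine ⟨hB i, fun t ω => M t ω i, martingale_apply hM i, ?_, ?_⟩
  · filter_upwards [hMc] with ω hω
    exact (continuous_apply i).comp hω
  · filter_upwards [hX, hd, ae_all_iff.2 hB] with ω h0 h1 h2 t
    have hte : t ≤ e := Subtype.coe_le_coe.1 (t.2.2.trans he.ge)
    have h3 := congrFun (h1 t e hte) i
    have h4 : Set.Ioc t e = Set.Ioi t := by
      ext s
      have : s ≤ e := Subtype.coe_le_coe.1 (s.2.2.trans he.ge)
      simp [this]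
    rw [h0 e he, h4] at h3
    simp only [Pi.sub_apply, Pi.add_apply, Pi.zero_apply] at h3
    rw [eval_integral fun j => (h2 j).restrict] at h3
    rw [tail]
    linarith

lemma Driven.add (hx : Driven ℱ P e x b) (hy : Driven ℱ P e y c) :
    Driven ℱ P e (fun t ω => x t ω + y t ω) (fun t ω => b t ω + c t ω) := by
  obtain ⟨hb, M, hM, hMc, hMd⟩ := hx
  obtain ⟨hc, N, hN, hNc, hNd⟩ := hy
  refine ⟨?_, M + N, hM.add hN, ?_, ?_⟩
  · filter_upwards [hb, hc] with ω h1 h2 using h1.add h2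
  · filter_upwards [hMc, hNc] with ω h1 h2 using h1.add h2
  · filter_upwards [hb, hc, hMd, hNd] with ω h1 h2 h3 h4 t
    -- Path integrability is part of `Driven` for this additivity: the integral of a nonintegrable
    -- drift would default to zero.
    have h5 : tail (fun t ω => b t ω + c t ω) t ω = tail b t ω + tail c t ω :=
      integral_add h1.restrict h2.restrict
    rw [h5, Pi.add_apply, Pi.add_apply, Pi.add_apply, Pi.add_apply]
    linarith [h3 t, h4 t]

lemma driven_zero : Driven ℱ P e (fun _ _ => 0) (fun _ _ => 0) := by
  refine ⟨Eventually.of_forall fun ω => integrable_zero _ _ _, 0, martingale_zero _ ℱ P,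
    Eventually.of_forall fun ω => continuous_const, Eventually.of_forall fun ω t => ?_⟩
  simp [tail]

lemma Driven.sum {ι : Type*} (s : Finset ι) {X B : ι → Period T → Ω → ℝ}
    (hX : ∀ i ∈ s, Driven ℱ P e (X i) (B i)) :
    Driven ℱ P e (fun t ω => ∑ i ∈ s, X i t ω) (fun t ω => ∑ i ∈ s, B i t ω) := by
  classical
  induction s using Finset.induction_on with
  | empty => simpa using driven_zero
  | insert a s ha ih =>
    simp_rw [Finset.sum_insert ha]
    exact (hX a (Finset.mem_insert_self _ _)).add
      (ih fun i hi => hX i (Finset.mem_insert_of_mem hi))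

lemma Driven.congr (hx : Driven ℱ P e x b) (hxy : ∀ᵐ ω ∂P, ∀ t, x t ω = y t ω)
    (hbc : ∀ᵐ ω ∂P, ∀ᵐ t ∂(leb T), b t ω = c t ω) : Driven ℱ P e y c := by
  obtain ⟨hb, M, hM, hMc, hMd⟩ := hx
  refine ⟨?_, M, hM, hMc, ?_⟩
  · filter_upwards [hb, hbc] with ω h1 h2 using h1.congr h2
  · filter_upwards [hxy, hbc, hMd] with ω h1 h2 h3 t
    have h4 : tail c t ω = tail b t ω :=
      integral_congr_ae (ae_restrict_of_ae (h2.mono fun _ h => h.symm))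
    rw [h4, ← h1]
    exact h3 t

/-- The factor `H` is known at time `t` and can be pulled out of the conditional expectation of the
increment, which is zero. -/
lemma integral_mul_martingale_sub [IsFiniteMeasure P] {M : Period T → Ω → ℝ}
    (hM : Martingale M ℱ P) {t u : Period T} (htu : t ≤ u) {H : Ω → ℝ}
    (hH : StronglyMeasurable[ℱ t] H)
    (hint : Integrable (fun ω => H ω * (M u ω - M t ω)) P) :
    ∫ ω, H ω * (M u ω - M t ω) ∂P = 0 := by
  have h1 : P[H * (M u - M t) | ℱ t] =ᵐ[P] H * P[M u - M t | ℱ t] :=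
    condExp_mul_of_stronglyMeasurable_left hH hint ((hM.integrable u).sub (hM.integrable t))
  have h2 : P[M u - M t | ℱ t] =ᵐ[P] 0 := by
    refine (condExp_sub (hM.integrable u) (hM.integrable t) _).trans ?_
    filter_upwards [hM.2 t u htu, hM.2 t t le_rfl] with ω h3 h4
    simp [h3, h4]
  have h5 := integral_condExp (μ := P) (f := H * (M u - M t)) (ℱ.le t)
  have h6 : ∫ ω, H ω * (M u ω - M t ω) ∂P = ∫ ω, (H * (M u - M t)) ω ∂P := rfl
  rw [h6, ← h5]
  refine integral_eq_zero_of_ae (h1.trans ?_)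
  filter_upwards [h2] with ω h7
  simp [h7]

/-- Testing the dynamics of `x` against an adapted process. -/
lemma Driven.integral_mul_eq_neg_tail [IsFiniteMeasure P] (he : IsTop e)
    (hd : Driven ℱ P e x b) (hx : SqIntegrable P x) (hb : SqIntegrable P b)
    (hh : SqIntegrable P h) (hadap : StronglyAdapted ℱ h) :
    ∫ p, h p.1 p.2 * x p.1 p.2 ∂((leb T).prod P) =
      -∫ p, h p.1 p.2 * tail b p.1 p.2 ∂((leb T).prod P) := by
  obtain ⟨-, M, hM, -, hMd⟩ := hd
  rw [integral_prod _ (hh.integrable_mul hx), integral_prod _ (hh.integrable_mul hb.tail),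
    ← integral_neg]
  refine integral_congr_ae ?_
  filter_upwards [hh.memLp_section, hx.memLp_section, hb.tail.memLp_section] with t h1 h2 h3
  -- The martingale is not assumed square integrable: at almost every time its remaining increment
  -- is -x - `tail b`, a sum of square integrable variables.
  have hM2 : MemLp (fun ω => M e ω - M t ω) 2 P := by
    refine (h2.neg.sub h3).ae_eq ?_
    filter_upwards [hMd] with ω h4
    simp only [Pi.sub_apply, Pi.neg_apply]
    linarith [h4 t]
  have h0 := integral_mul_martingale_sub hM (he t) (hadap t) (h1.integrable_mul hM2)
  have h5 : ∫ ω, h t ω * x t ω ∂P =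
      ∫ ω, (-(h t ω * tail b t ω) - h t ω * (M e ω - M t ω)) ∂P := by
    refine integral_congr_ae ?_
    filter_upwards [hMd] with ω h4
    linear_combination h t ω * h4 t
  have h6 : Integrable (fun ω => h t ω * tail b t ω) P := h1.integrable_mul h3
  have h7 : Integrable (fun ω => h t ω * (M e ω - M t ω)) P := h1.integrable_mul hM2
  have h8 : Integrable (fun ω => -(h t ω * tail b t ω)) P := h6.neg
  rw [h5, integral_sub h8 h7, h0, integral_neg, sub_zero]

lemma Driven.integral_mul_eq_neg_primitive [IsFiniteMeasure P] (he : IsTop e)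
    (hd : Driven ℱ P e x b) (hx : SqIntegrable P x) (hb : SqIntegrable P b)
    (hh : SqIntegrable P h) (hadap : StronglyAdapted ℱ h) :
    ∫ p, h p.1 p.2 * x p.1 p.2 ∂((leb T).prod P) =
      -∫ p, primitive h p.1 p.2 * b p.1 p.2 ∂((leb T).prod P) := by
  rw [hd.integral_mul_eq_neg_tail he hx hb hh hadap, integral_mul_tail hh hb]

lemma integral_primitive_mul_self [IsFiniteMeasure P] (he : IsTop e) (hx : SqIntegrable P x) :
    ∫ p, primitive x p.1 p.2 * x p.1 p.2 ∂((leb T).prod P) =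
      ∫ ω, primitive x e ω ^ 2 / 2 ∂P := by
  rw [integral_prod_symm _ (hx.primitive.integrable_mul hx)]
  refine integral_congr_ae ?_
  filter_upwards [hx.integrable_path] with ω h1
  exact integral_setIntegral_Iic_mul_self he h1

/-- Along almost every path this square is the time integral of the primitive times `x`, a product
of two square integrable processes. -/
lemma SqIntegrable.integrable_primitive_sq [IsFiniteMeasure P] (he : IsTop e)
    (hx : SqIntegrable P x) : Integrable (fun ω => PriceImpact.primitive x e ω ^ 2 / 2) P := by
  have h := (hx.primitive.integrable_mul hx).integral_prod_right
  refine h.congr ?_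
  filter_upwards [hx.integrable_path] with ω h1
  exact integral_setIntegral_Iic_mul_self he h1

lemma SqIntegrable.exp_mul (r : ℝ) (hx : SqIntegrable P x) :
    SqIntegrable P (fun t ω => Real.exp (-r * (t : ℝ)) * x t ω) := by
  have hm : Measurable (fun p : Period T × Ω => Real.exp (-r * (p.1 : ℝ))) := by fun_prop
  refine MemLp.of_le_mul (c := Real.exp (|r| * T)) hx (hm.aestronglyMeasurable.mul hx.1)
    (Eventually.of_forall fun p => ?_)
  rw [norm_mul, Real.norm_eq_abs (Real.exp _), Real.abs_exp]
  refine mul_le_mul_of_nonneg_right (Real.exp_le_exp.2 ?_) (norm_nonneg _)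
  calc -r * (p.1 : ℝ) ≤ |r| * p.1 := mul_le_mul_of_nonneg_right (neg_le_abs r) p.1.2.1
    _ ≤ |r| * T := mul_le_mul_of_nonneg_left p.1.2.2 (abs_nonneg r)

/-- The integration by parts `E ∫ e^{-rt} X (dx - r x dt) = - E ∫ e^{-rt} x² dt` for `X = ∫ x dt`. -/
lemma Driven.integral_exp_mul [IsFiniteMeasure P] (he : IsTop e) (r : ℝ)
    (hd : Driven ℱ P e x b) (hx : SqIntegrable P x) (hb : SqIntegrable P b)
    (hopt : Measurable[optionalSigma ℱ] (fun p : Period T × Ω => x p.1 p.2)) :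
    ∫ p, Real.exp (-r * (p.1 : ℝ)) * (primitive x p.1 p.2 * (b p.1 p.2 - r * x p.1 p.2) +
      x p.1 p.2 * x p.1 p.2) ∂((leb T).prod P) = 0 := by
  -- Test with e^{-rt} x and with r e^{-rt} X, X being the primitive of x. Since ∫₀ᵗ e^{-rs} x ds =
  -- e^{-rt} X + ∫₀ᵗ r e^{-rs} X ds, the nested primitives cancel on subtraction.
  have h1s := hx.exp_mul r
  have h2s := (hx.primitive.exp_mul r).const_mul r
  have h1 := hd.integral_mul_eq_neg_primitive he hx hb h1s fun t =>
    (stronglyAdapted_of_optional hopt t).const_mul _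
  have h2 := hd.integral_mul_eq_neg_primitive he hx hb h2s fun t =>
    ((stronglyAdapted_primitive hopt t).const_mul _).const_mul _
  have hparts : ∫ p, primitive (fun t ω => Real.exp (-r * (t : ℝ)) * x t ω) p.1 p.2 * b p.1 p.2
      ∂((leb T).prod P) =
      ∫ p, (Real.exp (-r * (p.1 : ℝ)) * primitive x p.1 p.2 * b p.1 p.2 +
        primitive (fun t ω => r * (Real.exp (-r * (t : ℝ)) * primitive x t ω)) p.1 p.2 *
          b p.1 p.2) ∂((leb T).prod P) := by
    refine integral_congr_ae ?_
    have hp : ∀ᵐ p ∂((leb T).prod P), Integrable (fun t => x t p.2) (leb T) :=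
      Measure.quasiMeasurePreserving_snd.ae hx.integrable_path
    filter_upwards [hp] with p hp
    rw [← add_mul]
    congr 1
    rw [primitive, setIntegral_Iic_exp_mul r hp p.1]
    simp_rw [primitive, mul_assoc]
  have i1 := (hx.primitive.exp_mul r).integrable_mul hb
  have i2 := h2s.primitive.integrable_mul hb
  have i3 := h1s.integrable_mul hx
  have i4 := h2s.integrable_mul hx
  rw [integral_add i1 i2] at hparts
  have hsum : ∫ p, Real.exp (-r * (p.1 : ℝ)) * (primitive x p.1 p.2 *
      (b p.1 p.2 - r * x p.1 p.2) + x p.1 p.2 * x p.1 p.2) ∂((leb T).prod P) =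
      ∫ p, ((Real.exp (-r * (p.1 : ℝ)) * primitive x p.1 p.2 * b p.1 p.2 -
        r * (Real.exp (-r * (p.1 : ℝ)) * primitive x p.1 p.2) * x p.1 p.2) +
        Real.exp (-r * (p.1 : ℝ)) * x p.1 p.2 * x p.1 p.2) ∂((leb T).prod P) := by
    refine integral_congr_ae (Eventually.of_forall fun p => ?_)
    simp only
    ring
  have i5 : Integrable (fun p : Period T × Ω => Real.exp (-r * (p.1 : ℝ)) *
      primitive x p.1 p.2 * b p.1 p.2 -
      r * (Real.exp (-r * (p.1 : ℝ)) * primitive x p.1 p.2) * x p.1 p.2) ((leb T).prod P) :=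
    i1.sub i4
  rw [hsum, integral_add i5 i3, integral_sub i1 i4]
  linarith

/-- A process that is identically zero has zero drift. -/
lemma Driven.drift_eq_zero [IsFiniteMeasure P] (hT : 0 < T) (he : IsTop e)
    (hd : Driven ℱ P e (fun _ _ => 0) b) (hb : SqIntegrable P b)
    (hopt : Measurable[optionalSigma ℱ] (fun p : Period T × Ω => b p.1 p.2)) :
    ∀ᵐ ω ∂P, ∀ᵐ t ∂(leb T), b t ω = 0 := by
  have h0 : SqIntegrable P (fun (_ : Period T) (_ : Ω) => (0 : ℝ)) := MemLp.zero'
  -- Write B for the primitive of b. Testing the zero process with b gives E B(e)² / 2 = 0.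
  have hfin : ∀ᵐ ω ∂P, primitive b e ω = 0 := by
    have h1 := hd.integral_mul_eq_neg_primitive he h0 hb hb (stronglyAdapted_of_optional hopt)
    simp only [mul_zero, integral_zero] at h1
    rw [integral_primitive_mul_self he hb, eq_comm, neg_eq_zero,
      integral_eq_zero_iff_of_nonneg (fun ω => by positivity) (hb.integrable_primitive_sq he)] at h1
    filter_upwards [h1] with ω h2
    simpa using h2
  -- Since B(e) = 0, the tail of b is -B; testing with B now gives E∫ B² = 0.
  have h1 := hd.integral_mul_eq_neg_tail he h0 hb hb.primitive (stronglyAdapted_primitive hopt)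
  simp only [mul_zero, integral_zero] at h1
  have h2 : ∫ p, primitive b p.1 p.2 * tail b p.1 p.2 ∂((leb T).prod P) =
      -∫ p, primitive b p.1 p.2 * primitive b p.1 p.2 ∂((leb T).prod P) := by
    rw [← integral_neg]
    refine integral_congr_ae ?_
    have hp : ∀ᵐ p ∂((leb T).prod P), primitive b e p.2 = 0 ∧
        Integrable (fun t => b t p.2) (leb T) :=
      Measure.quasiMeasurePreserving_snd.ae (hfin.and hb.integrable_path)
    filter_upwards [hp] with p hp
    have h3 : tail b p.1 p.2 = primitive b e p.2 - primitive b p.1 p.2 :=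
      setIntegral_Ioi_eq_sub he hp.2 p.1
    rw [h3, hp.1]
    ring
  rw [h2, neg_neg, eq_comm, integral_eq_zero_iff_of_nonneg (fun p => mul_self_nonneg _)
    (hb.primitive.integrable_mul hb.primitive)] at h1
  have h3 : ∀ᵐ p ∂((leb T).prod P), primitive b p.1 p.2 = 0 := by
    filter_upwards [h1] with p hp
    simpa using hp
  have := isOpenPosMeasure_leb hT
  filter_upwards [ae_ae_of_ae_prod_leb (p := fun t ω => primitive b t ω = 0) h3, hb.integrable_path] with ω h4 h5
  have h6 : (fun t => primitive b t ω) = fun _ => 0 :=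
    Continuous.ae_eq_iff_eq (leb T) (continuous_setIntegral_Iic h5) continuous_const |>.1 h4
  exact ae_eq_zero_of_setIntegral_Iic_eq_zero h5 fun t => congrFun h6 t

/-- A process with zero drift and zero terminal value that vanishes almost everywhere vanishes
identically. -/
lemma Driven.eq_zero_of_ae (hT : 0 < T)
    (hd : Driven ℱ P e x (fun _ _ => 0)) (hx : ∀ᵐ ω ∂P, ∀ᵐ t ∂(leb T), x t ω = 0) :
    ∀ᵐ ω ∂P, ∀ t, x t ω = 0 := by
  obtain ⟨-, M, hM, hMc, hMd⟩ := hd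
  have := isOpenPosMeasure_leb hT
  filter_upwards [hMc, hMd, hx] with ω h1 h2 h3
  -- Without drift, x inherits continuity from the martingale.
  have h4 : (fun t => x t ω) = fun t => M t ω - M e ω := by
    funext t
    have h5 := h2 t
    simp only [tail, integral_zero] at h5
    linarith
  have hc : Continuous fun t => x t ω := by
    rw [h4]
    exact h1.sub continuous_const
  exact congrFun ((hc.ae_eq_iff_eq (leb T) continuous_const).1 h3)

end Driven

/-! ### Vector-valued processes -/

section Vector

variable {T : ℝ} {Ω : Type*} {mΩ : MeasurableSpace Ω} {ℱ : Filtration (Period T) mΩ}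
  {P : Measure Ω} {d : ℕ} {X Y : Proc T Ω d}

lemma ae_prod_of_ae_forall [SFinite P] {p : Period T → Ω → Prop} (h : ∀ᵐ ω ∂P, ∀ t, p t ω) :
    ∀ᵐ q ∂((leb T).prod P), p q.1 q.2 := by
  filter_upwards [Measure.quasiMeasurePreserving_snd.ae h] with q hq using hq q.1

lemma ae_prod_of_ae_ae [SFinite P] {p : Period T → Ω → Prop}
    (hp : MeasurableSet {q : Period T × Ω | p q.1 q.2})
    (h : ∀ᵐ ω ∂P, ∀ᵐ t ∂(leb T), p t ω) : ∀ᵐ q ∂((leb T).prod P), p q.1 q.2 :=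
  (Measure.ae_prod_iff_ae_ae hp).2 ((Measure.ae_ae_comm hp).2 h)

lemma exists_norm_toLp_le (d : ℕ) :
    ∃ K : ℝ, 0 ≤ K ∧ ∀ x : Fin d → ℝ, ‖WithLp.toLp 2 x‖ ≤ K * ‖x‖ := by
  let A : (Fin d → ℝ) →L[ℝ] PiLp 2 (fun _ : Fin d => ℝ) :=
    (PiLp.continuousLinearEquiv 2 ℝ fun _ : Fin d => ℝ).symm.toContinuousLinearMap
  exact ⟨‖A‖, norm_nonneg _, fun x => A.le_opNorm x⟩

lemma norm_le_norm_toLp (x : Fin d → ℝ) : ‖x‖ ≤ ‖WithLp.toLp 2 x‖ :=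
  (pi_norm_le_iff_of_nonneg (norm_nonneg _)).2 fun i => PiLp.norm_apply_le (WithLp.toLp 2 x) i

/-- Norms on ℝ^d are equivalent; the sup norm is the one for which operator norms on `Fin d → ℝ`
apply directly. -/
lemma memHInf_iff : MemHInf ℱ P X ↔
    IsOptional ℱ X ∧ ∃ C : ℝ, ∀ᵐ ω ∂P, ∀ᵐ t ∂(leb T), ‖X t ω‖ ≤ C := by
  refine and_congr_right fun _ => ⟨?_, ?_⟩
  · rintro ⟨C, hC⟩
    refine ⟨C, ?_⟩
    filter_upwards [hC] with ω h
    filter_upwards [h] with t ht using (norm_le_norm_toLp _).trans ht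
  · rintro ⟨C, hC⟩
    obtain ⟨K, hK, hKle⟩ := exists_norm_toLp_le d
    refine ⟨K * C, ?_⟩
    filter_upwards [hC] with ω h
    filter_upwards [h] with t ht
    exact (hKle _).trans (mul_le_mul_of_nonneg_left ht hK)

lemma MemHInf.add (hX : MemHInf ℱ P X) (hY : MemHInf ℱ P Y) :
    MemHInf ℱ P (fun t ω => X t ω + Y t ω) := by
  rw [memHInf_iff] at *
  obtain ⟨hX, C, hC⟩ := hX
  obtain ⟨hY, D, hD⟩ := hY
  refine ⟨Measurable.add hX hY, C + D, ?_⟩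
  filter_upwards [hC, hD] with ω h1 h2
  filter_upwards [h1, h2] with t h3 h4 using norm_add_le_of_le h3 h4

lemma MemHInf.clm (A : (Fin d → ℝ) →L[ℝ] (Fin d → ℝ)) (hX : MemHInf ℱ P X) :
    MemHInf ℱ P (fun t ω => A (X t ω)) := by
  rw [memHInf_iff] at *
  obtain ⟨hX, C, hC⟩ := hX
  refine ⟨A.measurable.comp hX, ‖A‖ * C, ?_⟩
  filter_upwards [hC] with ω h1
  filter_upwards [h1] with t h2 using A.le_opNorm_of_le h2

lemma MemHInf.smul (c : ℝ) (hX : MemHInf ℱ P X) : MemHInf ℱ P (fun t ω => c • X t ω) :=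
  hX.clm (c • ContinuousLinearMap.id ℝ _)

lemma MemHInf.sub (hX : MemHInf ℱ P X) (hY : MemHInf ℱ P Y) :
    MemHInf ℱ P (fun t ω => X t ω - Y t ω) := by
  simpa [sub_eq_add_neg] using hX.add (hY.smul (-1))

lemma MemHInf.mulVec (A : Matrix (Fin d) (Fin d) ℝ) (hX : MemHInf ℱ P X) :
    MemHInf ℱ P (fun t ω => A *ᵥ X t ω) :=
  hX.clm (LinearMap.toContinuousLinearMap (Matrix.toLin' A))

lemma memHInf_zero : MemHInf ℱ P (fun _ _ => (0 : Fin d → ℝ)) :=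
  memHInf_iff.2 ⟨measurable_const, 0, by simp⟩

lemma MemHInf.sum {ι : Type*} (s : Finset ι) {F : ι → Proc T Ω d}
    (hF : ∀ i ∈ s, MemHInf ℱ P (F i)) : MemHInf ℱ P (fun t ω => ∑ i ∈ s, F i t ω) := by
  classical
  induction s using Finset.induction_on with
  | empty => simpa using memHInf_zero
  | insert a s ha ih =>
    simp_rw [Finset.sum_insert ha]
    exact (hF a (Finset.mem_insert_self _ _)).add
      (ih fun i hi => hF i (Finset.mem_insert_of_mem hi))

lemma MemHInf.memHTwo [IsFiniteMeasure P] (hX : MemHInf ℱ P X) : MemHTwo ℱ P X := by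
  obtain ⟨hX, C, hC⟩ := hX
  refine ⟨hX, ?_⟩
  have h : ∫⁻ ω, (∫⁻ t, ‖WithLp.toLp 2 (X t ω)‖ₑ ^ 2 ∂(leb T)) ∂P ≤
      ∫⁻ _, (∫⁻ _, ENNReal.ofReal C ^ 2 ∂(leb T)) ∂P := by
    refine lintegral_mono_ae ?_
    filter_upwards [hC] with ω h1
    refine lintegral_mono_ae ?_
    filter_upwards [h1] with t h2
    gcongr
    rw [← ofReal_norm]
    exact ENNReal.ofReal_le_ofReal h2
  refine h.trans_lt ?_
  simp only [lintegral_const]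
  finiteness

lemma IsOptional.apply (hX : IsOptional ℱ X) (i : Fin d) :
    Measurable[optionalSigma ℱ] (fun p : Period T × Ω => X p.1 p.2 i) :=
  (measurable_pi_apply i).comp hX

/-- Square integrability of the components of a process. -/
def SqIntegrableVec (P : Measure Ω) (X : Proc T Ω d) : Prop :=
  ∀ i, SqIntegrable P (fun t ω => X t ω i)

lemma MemHTwo.sqIntegrableVec [SFinite P] (hT : 0 < T) (hX : MemHTwo ℱ P X) :
    SqIntegrableVec P X := by
  intro i
  have hm : Measurable (fun p : Period T × Ω => X p.1 p.2 i) :=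
    (hX.1.apply i).mono (optionalSigma_le hT ℱ) le_rfl
  refine ⟨hm.aestronglyMeasurable, ?_⟩
  rw [eLpNorm_lt_top_iff_lintegral_rpow_enorm_lt_top two_ne_zero ENNReal.ofNat_ne_top,
    lintegral_prod_symm' _ (by fun_prop)]
  refine lt_of_le_of_lt ?_ hX.2
  refine lintegral_mono fun ω => lintegral_mono fun t => ?_
  simp only [ENNReal.toReal_ofNat, ENNReal.rpow_ofNat]
  gcongr
  rw [← ofReal_norm, ← ofReal_norm]
  exact ENNReal.ofReal_le_ofReal (PiLp.norm_apply_le (WithLp.toLp 2 (X t ω)) i)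

lemma MemHInf.sqIntegrableVec [IsFiniteMeasure P] (hT : 0 < T) (hX : MemHInf ℱ P X) :
    SqIntegrableVec P X := hX.memHTwo.sqIntegrableVec hT

lemma SqIntegrableVec.add (hX : SqIntegrableVec P X) (hY : SqIntegrableVec P Y) :
    SqIntegrableVec P (fun t ω => X t ω + Y t ω) := fun i => (hX i).add (hY i)

lemma SqIntegrableVec.smul (c : ℝ) (hX : SqIntegrableVec P X) :
    SqIntegrableVec P (fun t ω => c • X t ω) := fun i => (hX i).const_mul c

lemma SqIntegrableVec.sub (hX : SqIntegrableVec P X) (hY : SqIntegrableVec P Y) :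
    SqIntegrableVec P (fun t ω => X t ω - Y t ω) := by
  simpa [sub_eq_add_neg] using hX.add (hY.smul (-1))

lemma SqIntegrableVec.mulVec (A : Matrix (Fin d) (Fin d) ℝ) (hX : SqIntegrableVec P X) :
    SqIntegrableVec P (fun t ω => A *ᵥ X t ω) := fun i =>
  SqIntegrable.sum Finset.univ fun j _ => (hX j).const_mul (A i j)

lemma SqIntegrableVec.congr [SFinite P] (hX : SqIntegrableVec P X)
    (h : ∀ᵐ ω ∂P, ∀ t, X t ω = Y t ω) : SqIntegrableVec P Y := fun i => by
  refine (hX i).congr ?_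
  filter_upwards [ae_prod_of_ae_forall h] with p hp
  rw [hp]

lemma SqIntegrableVec.integrable_exp_dotProduct (r : ℝ) (hX : SqIntegrableVec P X)
    (hY : SqIntegrableVec P Y) :
    Integrable (fun p : Period T × Ω => Real.exp (-r * (p.1 : ℝ)) *
      (X p.1 p.2 ⬝ᵥ Y p.1 p.2)) ((leb T).prod P) := by
  simp_rw [dotProduct, Finset.mul_sum, ← mul_assoc]
  exact integrable_finsetSum _ fun i _ => ((hX i).exp_mul r).integrable_mul (hY i)

lemma IsPrimitive.apply [SFinite P] (hXY : IsPrimitive P X Y) (hY : SqIntegrableVec P Y) :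
    ∀ᵐ ω ∂P, ∀ t i, X t ω i = primitive (fun t ω => Y t ω i) t ω := by
  filter_upwards [hXY, ae_all_iff.2 fun i => (hY i).integrable_path] with ω h1 h2 t i
  rw [h1 t, eval_integral fun j => (h2 j).restrict]
  rfl

lemma IsPrimitive.sqIntegrableVec [IsFiniteMeasure P] (hXY : IsPrimitive P X Y)
    (hY : SqIntegrableVec P Y) : SqIntegrableVec P X := by
  have h : SqIntegrableVec P (fun t ω i => primitive (fun t ω => Y t ω i) t ω) :=
    fun i => (hY i).primitive
  refine h.congr ?_
  filter_upwards [hXY.apply hY] with ω h t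
  funext i
  exact (h t i).symm

/-- The primitive of a bounded optional process has a bounded optional version. -/
lemma IsPrimitive.exists_memHInf [IsFiniteMeasure P] (hT : 0 < T) (hXY : IsPrimitive P X Y)
    (hY : MemHInf ℱ P Y) :
    ∃ X' : Proc T Ω d, MemHInf ℱ P X' ∧ ∀ᵐ ω ∂P, ∀ t, X t ω = X' t ω := by
  obtain ⟨hYo, C, hC⟩ := memHInf_iff.1 hY
  -- Clipping changes Y only on a null set but makes every path bounded, so every path of the
  -- primitive is continuous and the primitive is optional without completing the filtration.
  let Z : Proc T Ω d := fun t ω i => max (-|C|) (min |C| (Y t ω i))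
  have hclip : Measurable (fun y : ℝ => max (-|C|) (min |C| y)) := by fun_prop
  have hZo : ∀ i, Measurable[optionalSigma ℱ] (fun p : Period T × Ω => Z p.1 p.2 i) := fun i =>
    hclip.comp (hYo.apply i)
  have hZb : ∀ t ω i, ‖Z t ω i‖ ≤ |C| := fun t ω i => by
    rw [Real.norm_eq_abs, abs_le]
    refine ⟨le_max_left _ _, max_le ?_ (min_le_left _ _)⟩
    linarith [abs_nonneg C]
  have hZi : ∀ ω i, Integrable (fun t => Z t ω i) (leb T) := fun ω i => by
    have hm : Measurable (fun p : Period T × Ω => Z p.1 p.2 i) :=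
      (hZo i).mono (optionalSigma_le hT ℱ) le_rfl
    exact Integrable.of_bound (hm.comp measurable_prodMk_right).aestronglyMeasurable |C|
      (Eventually.of_forall fun t => hZb t ω i)
  refine ⟨fun t ω i => primitive (fun t ω => Z t ω i) t ω, memHInf_iff.2 ⟨?_, ?_⟩, ?_⟩
  · refine @measurable_pi_lambda _ _ _ (optionalSigma ℱ) _ _ fun i => ?_
    exact measurable_optionalSigma_of_continuous (stronglyAdapted_primitive (hZo i))
      fun ω => continuous_setIntegral_Iic (hZi ω i)
  · refine ⟨|C| * (leb T).real Set.univ, Eventually.of_forall fun ω =>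
      Eventually.of_forall fun t => ?_⟩
    refine (pi_norm_le_iff_of_nonneg (by positivity)).2 fun i => ?_
    refine (norm_setIntegral_le_of_norm_le_const (measure_lt_top _ _)
      fun s _ => hZb s ω i).trans ?_
    exact mul_le_mul_of_nonneg_left (measureReal_mono (Set.subset_univ _)) (abs_nonneg C)
  · filter_upwards [hXY.apply (hY.sqIntegrableVec hT), hC] with ω h1 h2 t
    funext i
    rw [h1 t i]
    refine integral_congr_ae (ae_restrict_of_ae ?_)
    filter_upwards [h2] with s hs
    have h3 := abs_le.1 (((norm_le_pi_norm _ i).trans hs).trans (le_abs_self C))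
    change Y s ω i = max (-|C|) (min |C| (Y s ω i))
    rw [min_eq_right h3.2, max_eq_right h3.1]

lemma Driven.of_memA [IsFiniteMeasure P] (hT : 0 < T) {a : Proc T Ω d} (hX : MemA ℱ P X a)
    (i : Fin d) : Driven ℱ P (horizon hT) (fun t ω => X t ω i) (fun t ω => a t ω i) := by
  obtain ⟨-, ha, h0, M, hM, hMc, -, hd⟩ := hX
  exact Driven.of_hasDynamics rfl h0 hM hMc hd
    (fun i => (ha.sqIntegrableVec hT i).integrable_path) i

end Vector

/-! ### Aggregation of competitive strategies and uniqueness -/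

section Competitive

variable {T : ℝ} {Ω : Type*} {mΩ : MeasurableSpace Ω} {ℱ : Filtration (Period T) mΩ}
  {P : Measure Ω} {d : ℕ} {r δ : ℝ} {S L : Matrix (Fin d) (Fin d) ℝ}

/-- The drift of the trading rate of a competitive investor. -/
def competitiveDrift (r δ : ℝ) (S L : Matrix (Fin d) (Fin d) ℝ) (ζ ν θ θdot : Proc T Ω d) :
    Proc T Ω d :=
  fun t ω => (1 / (2 * δ)) • ((L⁻¹ * S) *ᵥ (θ t ω - frictionlessPortfolio δ S ζ ν t ω)) +
    r • θdot t ω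

/-- The drift is square integrable, hence integrable along paths, because the primitive of a rate in
ℋ² is square integrable and ν, ζ are bounded. -/
lemma SolvesCompetitiveFBSDE.driven [IsFiniteMeasure P] (hT : 0 < T)
    {ζ ν θ θdot : Proc T Ω d} (h : SolvesCompetitiveFBSDE ℱ P r δ S L ζ ν θ θdot)
    (hζ : MemHInf ℱ P ζ) (hν : MemHInf ℱ P ν) (i : Fin d) :
    Driven ℱ P (horizon hT) (fun t ω => θdot t ω i)
      (fun t ω => competitiveDrift r δ S L ζ ν θ θdot t ω i) := by
  obtain ⟨hp, hsq, h0, M, hM, -, hMc, hd⟩ := h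
  have hθd := hsq.sqIntegrableVec hT
  have hθ := hp.sqIntegrableVec hθd
  have hB : SqIntegrableVec P (competitiveDrift r δ S L ζ ν θ θdot) :=
    (((hθ.sub ((((hν.mulVec S⁻¹).smul δ).sub hζ).sqIntegrableVec hT)).mulVec (L⁻¹ * S)).smul
      (1 / (2 * δ))).add (hθd.smul r)
  exact Driven.of_hasDynamics rfl h0 hM hMc hd (fun i => (hB i).integrable_path) i

/-- After multiplication by `L` each competitive investor contributes S(θ + ζ)/(2δ) - ν/2 + r L θ̇.
Summing over `k` investors and adding and subtracting S(φ + ψ)/(2δ) isolates the price-impact return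
and the two clearing sums. -/
lemma mulVec_aggregate_drift (hS : IsUnit S.det) (hL : IsUnit L.det) (hδ : δ ≠ 0)
    {ι : Type*} (s : Finset ι) {k : ℝ} (hk : (s.card : ℝ) = k) (hk0 : k ≠ 0)
    (a a' φ φd ψ ψd ν : Fin d → ℝ) (ζ θ θd : ι → Fin d → ℝ) :
    L *ᵥ (a + ∑ m ∈ s, ((1 / (2 * δ)) • ((L⁻¹ * S) *ᵥ (θ m - (δ • (S⁻¹ *ᵥ ν) - ζ m))) +
        r • θd m) + a') =
      (k / 2) • (((2 / k) • L) *ᵥ (a - r • φd) +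
        ((1 / (δ * k)) • (S *ᵥ (∑ m ∈ s, ζ m - φ - ψ)) + ((2 / k) • L) *ᵥ (a' - r • ψd)) - ν) +
      (1 / (2 * δ)) • (S *ᵥ (φ + ∑ m ∈ s, θ m + ψ)) +
      r • (L *ᵥ (φd + ∑ m ∈ s, θd m + ψd)) := by
  have hLS : L * (L⁻¹ * S) = S := by rw [← Matrix.mul_assoc, Matrix.mul_nonsing_inv _ hL, one_mul]
  have hSν : S *ᵥ (S⁻¹ *ᵥ ν) = ν := by
    rw [Matrix.mulVec_mulVec, Matrix.mul_nonsing_inv _ hS, Matrix.one_mulVec]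
  have hsum : L *ᵥ (∑ m ∈ s, ((1 / (2 * δ)) • ((L⁻¹ * S) *ᵥ (θ m - (δ • (S⁻¹ *ᵥ ν) - ζ m))) +
        r • θd m)) =
      (1 / (2 * δ)) • (S *ᵥ (∑ m ∈ s, θ m) + S *ᵥ (∑ m ∈ s, ζ m)) - (k / 2) • ν +
        r • (L *ᵥ (∑ m ∈ s, θd m)) := by
    have hterm : ∀ m, L *ᵥ ((1 / (2 * δ)) • ((L⁻¹ * S) *ᵥ (θ m - (δ • (S⁻¹ *ᵥ ν) - ζ m))) +
        r • θd m) = (1 / (2 * δ)) • (S *ᵥ θ m + S *ᵥ ζ m) - (1 / 2 : ℝ) • ν +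
          r • (L *ᵥ θd m) := by
      intro m
      rw [Matrix.mulVec_add, Matrix.mulVec_smul, Matrix.mulVec_mulVec, hLS, Matrix.mulVec_smul,
        Matrix.mulVec_sub, Matrix.mulVec_sub, Matrix.mulVec_smul, hSν]
      ext i
      simp only [Pi.add_apply, Pi.sub_apply, Pi.smul_apply, smul_eq_mul]
      field_simp
      ring
    rw [Matrix.mulVec_sum, Finset.sum_congr rfl fun m _ => hterm m, Finset.sum_add_distrib,
      Finset.sum_sub_distrib, Finset.sum_const, ← Finset.smul_sum, ← Finset.smul_sum,
      Finset.sum_add_distrib, ← Matrix.mulVec_sum, ← Matrix.mulVec_sum, ← Matrix.mulVec_sum,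
      ← Nat.cast_smul_eq_nsmul ℝ, hk, smul_smul]
    congr 3
    ring
  rw [Matrix.mulVec_add, Matrix.mulVec_add, hsum]
  simp only [Matrix.mulVec_add, Matrix.mulVec_sub, Matrix.smul_mulVec, Matrix.mulVec_smul]
  ext i
  simp only [Pi.add_apply, Pi.sub_apply, Pi.smul_apply, smul_eq_mul]
  field_simp
  ring

/-- Uniqueness for the homogeneous linear system satisfied by the aggregate trading rate. -/
lemma eq_zero_of_driven_homogeneous [IsFiniteMeasure P] (hT : 0 < T) (hr : 0 ≤ r) (hδ : 0 < δ)
    (hS : S.PosSemidef) {l : Fin d → ℝ} (hl : ∀ i, 0 < l i)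
    {x : Fin d → Period T → Ω → ℝ} (hx : ∀ i, SqIntegrable P (x i))
    (hopt : ∀ i, Measurable[optionalSigma ℱ] (fun p : Period T × Ω => x i p.1 p.2))
    (hd : ∀ i, Driven ℱ P (horizon hT) (x i) (fun t ω =>
      (l i)⁻¹ * ((1 / (2 * δ)) * (S *ᵥ fun j => primitive (x j) t ω) i) + r * x i t ω)) :
    ∀ᵐ ω ∂P, ∀ t i, x i t ω = 0 := by
  have hQ : SqIntegrableVec P (fun t ω j => primitive (x j) t ω) := fun i => (hx i).primitive
  have hSQ := hQ.mulVec S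
  have hb : ∀ i, SqIntegrable P (fun t ω =>
      (l i)⁻¹ * ((1 / (2 * δ)) * (S *ᵥ fun j => primitive (x j) t ω) i) + r * x i t ω) := fun i =>
    (((hSQ i).const_mul _).const_mul _).add ((hx i).const_mul r)
  have henergy : ∀ i, l i * ∫ p, x i p.1 p.2 * x i p.1 p.2 ∂((leb T).prod P) +
      (1 / (2 * δ)) * (∫ p, primitive (x i) p.1 p.2 *
        (S *ᵥ fun j => primitive (x j) p.1 p.2) i ∂((leb T).prod P)) +
      l i * (r * ∫ p, primitive (x i) p.1 p.2 * x i p.1 p.2 ∂((leb T).prod P)) = 0 := by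
    intro i
    -- The test process is the rate itself; the weight `l i` removes its inverse from the drift, so
    -- that summing over i produces the quadratic form of `S`.
    have h1 := (hd i).integral_mul_eq_neg_primitive (isTop_horizon hT) (hx i) (hb i) (hx i)
      (stronglyAdapted_of_optional (hopt i))
    have h2 : ∫ p, primitive (x i) p.1 p.2 * ((l i)⁻¹ * ((1 / (2 * δ)) *
        (S *ᵥ fun j => primitive (x j) p.1 p.2) i) + r * x i p.1 p.2) ∂((leb T).prod P) =
        ∫ p, (((l i)⁻¹ * (1 / (2 * δ))) * (primitive (x i) p.1 p.2 *
          (S *ᵥ fun j => primitive (x j) p.1 p.2) i) +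
          r * (primitive (x i) p.1 p.2 * x i p.1 p.2)) ∂((leb T).prod P) := by
      refine integral_congr_ae (Eventually.of_forall fun p => ?_)
      simp only
      ring
    rw [h2, integral_add (((hx i).primitive.integrable_mul (hSQ i)).const_mul _)
      (((hx i).primitive.integrable_mul (hx i)).const_mul _), integral_const_mul,
      integral_const_mul] at h1
    rw [h1]
    have := (hl i).ne'
    field_simp
    ring
  have hsum := Finset.sum_eq_zero fun i (_ : i ∈ Finset.univ) => henergy i
  rw [Finset.sum_add_distrib, Finset.sum_add_distrib, ← Finset.mul_sum,
    ← integral_finsetSum _ fun i _ => (hx i).primitive.integrable_mul (hSQ i)] at hsum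
  have hpot : 0 ≤ ∫ p, ∑ i, primitive (x i) p.1 p.2 *
      (S *ᵥ fun j => primitive (x j) p.1 p.2) i ∂((leb T).prod P) := by
    refine integral_nonneg fun p => ?_
    have h := hS.dotProduct_mulVec_nonneg fun j => primitive (x j) p.1 p.2
    simpa [dotProduct] using h
  -- The discount term is r E X_i(T)² / 2, nonnegative because `r ≥ 0`.
  have hterminal : 0 ≤ ∑ i, l i *
      (r * ∫ p, primitive (x i) p.1 p.2 * x i p.1 p.2 ∂((leb T).prod P)) := by
    refine Finset.sum_nonneg fun i _ => mul_nonneg (hl i).le (mul_nonneg hr ?_)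
    rw [integral_primitive_mul_self (isTop_horizon hT) (hx i)]
    exact integral_nonneg fun ω => by positivity
  have hkin : ∀ i ∈ Finset.univ, 0 ≤ l i * ∫ p, x i p.1 p.2 * x i p.1 p.2 ∂((leb T).prod P) :=
    fun i _ => mul_nonneg (hl i).le (integral_nonneg fun p => mul_self_nonneg _)
  have hkin0 : ∑ i, l i * ∫ p, x i p.1 p.2 * x i p.1 p.2 ∂((leb T).prod P) = 0 := by
    refine le_antisymm ?_ (Finset.sum_nonneg hkin)
    have : 0 ≤ (1 / (2 * δ)) * ∫ p, ∑ i, primitive (x i) p.1 p.2 *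
      (S *ᵥ fun j => primitive (x j) p.1 p.2) i ∂((leb T).prod P) := by positivity
    linarith
  have hae : ∀ i, ∀ᵐ ω ∂P, ∀ᵐ t ∂(leb T), x i t ω = 0 := by
    intro i
    have h1 := (Finset.sum_eq_zero_iff_of_nonneg hkin).1 hkin0 i (Finset.mem_univ i)
    have h2 := (mul_eq_zero.1 h1).resolve_left (hl i).ne'
    rw [integral_eq_zero_iff_of_nonneg (fun p => mul_self_nonneg _)
      ((hx i).integrable_mul (hx i))] at h2
    refine ae_ae_of_ae_prod_leb (p := fun t ω => x i t ω = 0) ?_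
    filter_upwards [h2] with p hp
    simpa using hp
  have hzero : ∀ i, ∀ᵐ ω ∂P, ∀ t, x i t ω = 0 := by
    intro i
    -- Once all rates vanish almost everywhere so does the drift, and continuity gives vanishing at
    -- every time.
    refine Driven.eq_zero_of_ae hT ((hd i).congr (Eventually.of_forall fun ω t => rfl) ?_) (hae i)
    filter_upwards [ae_all_iff.2 hae] with ω h1
    have h2 : ∀ t, (fun j => primitive (x j) t ω) = 0 := by
      intro t
      funext j
      exact integral_eq_zero_of_ae (ae_restrict_of_ae (h1 j))
    filter_upwards [h1 i] with t h3
    rw [h2 t, h3]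
    simp
  filter_upwards [ae_all_iff.2 hzero] with ω h t i using h i t

end Competitive

/-! ### The price-impact process and the adjusted objective -/

section PriceImpactProcess

variable {T : ℝ} {Ω : Type*} {mΩ : MeasurableSpace Ω} {ℱ : Filtration (Period T) mΩ}
  {P : Measure Ω} {d N : ℕ} {r δ : ℝ} {S L : Matrix (Fin d) (Fin d) ℝ}
  {ζ : Fin N → Proc T Ω d} {n : Fin N} {φ φdot aφ ψ ψdot aψ ν : Proc T Ω d}

/-- The price-impact process has a version in `ℋ^∞`. -/
lemma exists_memHInf_impactReturn [IsFiniteMeasure P] (hT : 0 < T)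
    (hζ : ∀ m, MemHInf ℱ P (ζ m)) (hψ : MemWA ℱ P ψ ψdot aψ) (hφ : MemWA ℱ P φ φdot aφ) :
    ∃ ν : Proc T Ω d, MemHInf ℱ P ν ∧
      ∀ᵐ ω ∂P, ∀ t, impactReturn r δ S L ζ n φ φdot aφ ψ ψdot aψ t ω = ν t ω := by
  -- The demands are primitives only almost surely and need not be optional themselves, hence the
  -- versions.
  obtain ⟨φ', hφ', hφe⟩ := hφ.1.exists_memHInf hT hφ.2.1
  obtain ⟨ψ', hψ', hψe⟩ := hψ.1.exists_memHInf hT hψ.2.1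
  refine ⟨impactReturn r δ S L ζ n φ' φdot aφ ψ' ψdot aψ, ?_, ?_⟩
  · have h1 := (hφ.2.2.1.sub (hφ.2.1.smul r)).mulVec ((2 / ((N : ℝ) - 1)) • L)
    have h2 := (hψ.2.2.1.sub (hψ.2.1.smul r)).mulVec ((2 / ((N : ℝ) - 1)) • L)
    have h3 := ((((MemHInf.sum (Finset.univ.erase n) fun m _ => hζ m).sub hφ').sub hψ').mulVec
      S).smul (1 / (δ * ((N : ℝ) - 1)))
    exact h1.add (h3.add h2)
  · filter_upwards [hφe, hψe] with ω h1 h2 t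
    simp only [impactReturn, impactLinearPart, h1 t, h2 t]

lemma sqIntegrableVec_impactLinearPart [IsFiniteMeasure P] (hT : 0 < T)
    (hζ : ∀ m, MemHInf ℱ P (ζ m)) (hψ : MemWA ℱ P ψ ψdot aψ) (hφ : SqIntegrableVec P φ) :
    SqIntegrableVec P (impactLinearPart r δ S L ζ n φ ψ ψdot aψ) := by
  have h2 := ((hψ.2.2.1.sub (hψ.2.1.smul r)).mulVec
    ((2 / ((N : ℝ) - 1)) • L)).sqIntegrableVec hT
  have hψ' := hψ.1.sqIntegrableVec (hψ.2.1.sqIntegrableVec hT)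
  have h3 := (((((MemHInf.sum (Finset.univ.erase n) fun m _ => hζ m).sqIntegrableVec hT).sub
    hφ).sub hψ').mulVec S).smul (1 / (δ * ((N : ℝ) - 1)))
  exact h3.add h2

lemma isIntegrand_adjustedIntegrand [IsFiniteMeasure P] (hT : 0 < T)
    (hζ : ∀ m, MemHInf ℱ P (ζ m)) (hψ : MemWA ℱ P ψ ψdot aψ) (hφ : MemWA ℱ P φ φdot aφ) :
    IsIntegrand P (adjustedIntegrand r δ S L ζ n φ φdot ψ ψdot aψ) := by
  have hφd := hφ.2.1.sqIntegrableVec hT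
  have hφs := hφ.1.sqIntegrableVec hφd
  have hφζ := hφs.add ((hζ n).sqIntegrableVec hT)
  have h1 := hφs.integrable_exp_dotProduct r (sqIntegrableVec_impactLinearPart (r := r) (δ := δ)
    (S := S) (L := L) (n := n) hT hζ hψ hφs)
  have h2 := (hφζ.integrable_exp_dotProduct r (hφζ.mulVec S)).const_mul (1 / (2 * δ))
  have h3 := hφd.integrable_exp_dotProduct r (hφd.mulVec (L + (2 / ((N : ℝ) - 1)) • L))
  refine ((h1.sub h2).sub h3).congr (Eventually.of_forall fun p => ?_)
  simp only [Pi.sub_apply, adjustedIntegrand]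
  ring

lemma expectedIntegral_eq_integral_prod [SFinite P] {f : Period T → Ω → ℝ} (hf : IsIntegrand P f) :
    expectedIntegral P f = ∫ p, f p.1 p.2 ∂((leb T).prod P) :=
  (integral_prod_symm _ hf).symm

/-- Under the price-impact returns, the objective takes the adjusted form. -/
lemma frObjective_eq_adjustedObjective [IsFiniteMeasure P] (hT : 0 < T) (hL : L.IsDiag)
    (hζ : ∀ m, MemHInf ℱ P (ζ m)) (hψ : MemWA ℱ P ψ ψdot aψ) (hφ : MemWA ℱ P φ φdot aφ)
    (hν : ∀ᵐ p ∂((leb T).prod P),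
      ν p.1 p.2 = impactReturn r δ S L ζ n φ φdot aφ ψ ψdot aψ p.1 p.2) :
    IsIntegrand P (frIntegrand r δ S L (ζ n) ν φ φdot) ∧
      frObjective P r δ S L (ζ n) ν φ φdot =
        adjustedObjective P r δ S L ζ n φ φdot ψ ψdot aψ := by
  have hadj := isIntegrand_adjustedIntegrand (r := r) (δ := δ) (S := S) (L := L) (n := n)
    hT hζ hψ hφ
  have hφd := hφ.2.1.sqIntegrableVec hT
  have ha := hφ.2.2.1.sqIntegrableVec hT
  have hφs := hφ.1.sqIntegrableVec hφd
  set κ : ℝ := 2 / ((N : ℝ) - 1) with hκ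
  -- Since L is diagonal, the two integrands differ by ∑ κ L_ii g_i almost everywhere, and each g_i
  -- integrates to zero by the scalar integration by parts.
  let g : Fin d → Period T × Ω → ℝ := fun i p => Real.exp (-r * (p.1 : ℝ)) *
    (primitive (fun t ω => φdot t ω i) p.1 p.2 * (aφ p.1 p.2 i - r * φdot p.1 p.2 i) +
      φdot p.1 p.2 i * φdot p.1 p.2 i)
  have hgi : ∀ i, Integrable (g i) ((leb T).prod P) := by
    intro i
    have h1 := ((hφd i).primitive.exp_mul r).integrable_mul
      ((ha i).add ((hφd i).const_mul (-r)))
    have h2 := ((hφd i).exp_mul r).integrable_mul (hφd i)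
    refine (h1.add h2).congr (Eventually.of_forall fun p => ?_)
    simp only [Pi.add_apply, g]
    ring
  have hg0 : ∀ i, ∫ p, g i p ∂((leb T).prod P) = 0 := fun i =>
    (Driven.of_memA hT hφ.2 i).integral_exp_mul (isTop_horizon hT) r (hφd i) (ha i)
      (hφ.2.1.1.apply i)
  have heq : ∀ᵐ p ∂((leb T).prod P), adjustedIntegrand r δ S L ζ n φ φdot ψ ψdot aψ p.1 p.2 +
      ∑ i, κ * L i i * g i p = frIntegrand r δ S L (ζ n) ν φ φdot p.1 p.2 := by
    filter_upwards [hν, ae_prod_of_ae_forall (hφ.1.apply hφd)] with p h1 h2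
    have hdiag : ∀ u v : Fin d → ℝ, u ⬝ᵥ (L *ᵥ v) = ∑ i, u i * (L i i * v i) := by
      intro u v
      nth_rw 1 [← hL.diagonal_diag]
      simp [dotProduct, Matrix.mulVec_diagonal]
    simp only [adjustedIntegrand, frIntegrand, h1, impactReturn, dotProduct_add, Matrix.add_mulVec,
      Matrix.smul_mulVec, dotProduct_smul, smul_eq_mul, ← hκ]
    have hsum : ∑ i, κ * L i i * g i p = Real.exp (-r * (p.1 : ℝ)) *
        (κ * (φ p.1 p.2 ⬝ᵥ (L *ᵥ (aφ p.1 p.2 - r • φdot p.1 p.2))) +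
          κ * (φdot p.1 p.2 ⬝ᵥ (L *ᵥ φdot p.1 p.2))) := by
      rw [hdiag, hdiag, Finset.mul_sum, Finset.mul_sum, ← Finset.sum_add_distrib, Finset.mul_sum]
      refine Finset.sum_congr rfl fun i _ => ?_
      simp only [g, h2 i, Pi.sub_apply, Pi.smul_apply, smul_eq_mul]
      ring
    rw [hsum]
    ring
  have hsumi : Integrable (fun p => ∑ i, κ * L i i * g i p) ((leb T).prod P) :=
    integrable_finsetSum _ fun i _ => (hgi i).const_mul _
  have hfr : IsIntegrand P (frIntegrand r δ S L (ζ n) ν φ φdot) :=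
    (Integrable.add hadj hsumi).congr heq
  refine ⟨hfr, ?_⟩
  rw [frObjective, adjustedObjective, expectedIntegral_eq_integral_prod hfr,
    expectedIntegral_eq_integral_prod hadj, ← integral_congr_ae heq, integral_add hadj hsumi,
    integral_finsetSum _ fun i _ => (hgi i).const_mul _]
  simp [integral_const_mul, hg0]

/-- The market clears exactly when the returns are the price-impact process. -/
lemma marketClears_iff [IsFiniteMeasure P] (hT : 0 < T) (hr : 0 ≤ r) (hδ : 0 < δ) (hN : 2 ≤ N)
    (hS : S.PosDef) (hL : L.PosDef) (hLd : L.IsDiag) {θ θdot : Fin N → Proc T Ω d}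
    (hζ : ∀ m, MemHInf ℱ P (ζ m)) (hψ : MemWA ℱ P ψ ψdot aψ) (hφ : MemWA ℱ P φ φdot aφ)
    (hν : MemHInf ℱ P ν)
    (hθ : ∀ m, m ≠ n → SolvesCompetitiveFBSDE ℱ P r δ S L (ζ m) ν (θ m) (θdot m)) :
    MarketClears P n φ φdot θ θdot ψ ψdot ↔
      ∀ᵐ p ∂((leb T).prod P),
        ν p.1 p.2 = impactReturn r δ S L ζ n φ φdot aφ ψ ψdot aψ p.1 p.2 := by
  obtain ⟨ν', hν', hνe⟩ := exists_memHInf_impactReturn (r := r) (δ := δ) (S := S) (L := L)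
    (n := n) hT hζ hψ hφ
  have hcard : ((Finset.univ.erase n).card : ℝ) = (N : ℝ) - 1 := by
    rw [Finset.card_erase_of_mem (Finset.mem_univ n), Finset.card_univ, Fintype.card_fin,
      Nat.cast_sub (by omega), Nat.cast_one]
  have hk : (0 : ℝ) < (N : ℝ) - 1 := by
    have : (2 : ℝ) ≤ N := by exact_mod_cast hN
    linarith
  have hl : ∀ i, 0 < L i i := fun i => hL.diag_pos
  have hLi : ∀ (v : Fin d → ℝ) i, (L *ᵥ v) i = L i i * v i := by
    intro v i
    nth_rw 1 [← hLd.diagonal_diag]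
    simp [Matrix.mulVec_diagonal]
  let X : Proc T Ω d := fun t ω => φ t ω + ∑ m ∈ Finset.univ.erase n, θ m t ω + ψ t ω
  let x : Proc T Ω d := fun t ω => φdot t ω + ∑ m ∈ Finset.univ.erase n, θdot m t ω + ψdot t ω
  let b : Proc T Ω d := fun t ω => aφ t ω + ∑ m ∈ Finset.univ.erase n,
    competitiveDrift r δ S L (ζ m) ν (θ m) (θdot m) t ω + aψ t ω
  have hdrift : ∀ t ω i, b t ω i =
      (L i i)⁻¹ * (((N : ℝ) - 1) / 2 *
        (impactReturn r δ S L ζ n φ φdot aφ ψ ψdot aψ t ω i - ν t ω i) +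
      (1 / (2 * δ)) * (S *ᵥ X t ω) i) + r * x t ω i := by
    intro t ω i
    have h := congrFun (mulVec_aggregate_drift (L := L) (r := r) hS.det_pos.ne'.isUnit
      hL.det_pos.ne'.isUnit hδ.ne' (Finset.univ.erase n) hcard hk.ne' (aφ t ω) (aψ t ω) (φ t ω)
      (φdot t ω) (ψ t ω) (ψdot t ω) (ν t ω) (fun m => ζ m t ω) (fun m => θ m t ω)
      (fun m => θdot m t ω)) i
    have h' : L i i * b t ω i = ((N : ℝ) - 1) / 2 *
        (impactReturn r δ S L ζ n φ φdot aφ ψ ψdot aψ t ω i - ν t ω i) +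
        (1 / (2 * δ)) * (S *ᵥ X t ω) i + r * (L i i * x t ω i) := by
      rw [← hLi, ← hLi]
      exact h
    have h0 := (hl i).ne'
    rw [← mul_right_inj' h0, h']
    field_simp
  have hφd := hφ.2.1.sqIntegrableVec hT
  have hψd := hψ.2.1.sqIntegrableVec hT
  have hθd : ∀ m ∈ Finset.univ.erase n, SqIntegrableVec P (θdot m) := fun m hm =>
    (hθ m (Finset.ne_of_mem_erase hm)).2.1.sqIntegrableVec hT
  have hx : ∀ i, SqIntegrable P (fun t ω => x t ω i) := by
    intro i
    refine (((hφd i).add (SqIntegrable.sum _ fun m hm => hθd m hm i)).add (hψd i)).congr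
      (Eventually.of_forall fun p => ?_)
    simp [x]
  have hxo : ∀ i, Measurable[optionalSigma ℱ] (fun p : Period T × Ω => x p.1 p.2 i) := by
    intro i
    have h1 := Finset.measurable_fun_sum (m := optionalSigma ℱ) (Finset.univ.erase n)
      fun m hm => (hθ m (Finset.ne_of_mem_erase hm)).2.1.1.apply i
    have h2 := Measurable.add (Measurable.add (hφ.2.1.1.apply i) h1) (hψ.2.1.1.apply i)
    convert h2 using 2 with p
    simp [x]
  have hd : ∀ i, Driven ℱ P (horizon hT) (fun t ω => x t ω i) (fun t ω => b t ω i) := by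
    intro i
    have h := ((Driven.of_memA hT hφ.2 i).add (Driven.sum (Finset.univ.erase n) fun m hm =>
      (hθ m (Finset.ne_of_mem_erase hm)).driven hT (hζ m) hν i)).add (Driven.of_memA hT hψ.2 i)
    refine h.congr (Eventually.of_forall fun ω t => ?_)
      (Eventually.of_forall fun ω => Eventually.of_forall fun t => ?_)
    · simp [x]
    · simp [b]
  have hXx : ∀ᵐ ω ∂P, ∀ t i, X t ω i = primitive (fun t ω => x t ω i) t ω := by
    have hθp : ∀ᵐ ω ∂P, ∀ m ∈ Finset.univ.erase n, (∀ t i, θ m t ω i =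
        primitive (fun t ω => θdot m t ω i) t ω) ∧
        ∀ i, Integrable (fun t => θdot m t ω i) (leb T) := by
      refine (Finset.eventually_all _).2 fun m hm => ?_
      filter_upwards [(hθ m (Finset.ne_of_mem_erase hm)).1.apply (hθd m hm),
        ae_all_iff.2 fun i => (hθd m hm i).integrable_path] with ω h1 h2 using ⟨h1, h2⟩
    filter_upwards [hφ.1.apply hφd, hψ.1.apply hψd, hθp,
      ae_all_iff.2 fun i => (hφd i).integrable_path,
      ae_all_iff.2 fun i => (hψd i).integrable_path] with ω h1 h2 h3 h4 h5 t i
    have h6 : Integrable (fun s => ∑ m ∈ Finset.univ.erase n, θdot m s ω i)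
        ((leb T).restrict (Set.Iic t)) :=
      integrable_finsetSum _ fun m hm => ((h3 m hm).2 i).restrict
    have h7 : Integrable (fun s => φdot s ω i + ∑ m ∈ Finset.univ.erase n, θdot m s ω i)
        ((leb T).restrict (Set.Iic t)) := (h4 i).restrict.add h6
    simp only [X, x, primitive, Pi.add_apply, Finset.sum_apply]
    rw [integral_add h7 (h5 i).restrict, integral_add (h4 i).restrict h6,
      integral_finsetSum _ fun m hm => ((h3 m hm).2 i).restrict, h1 t i, h2 t i,
      Finset.sum_congr rfl fun m hm => (h3 m hm).1 t i]
    rfl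
  -- The optional version ν' makes the coincidence set measurable, which is needed to return from
  -- the iterated to the product statement.
  have hνν' : (∀ᵐ p ∂((leb T).prod P),
      ν p.1 p.2 = impactReturn r δ S L ζ n φ φdot aφ ψ ψdot aψ p.1 p.2) ↔
      ∀ᵐ ω ∂P, ∀ᵐ t ∂(leb T), ν t ω = ν' t ω := by
    constructor
    · intro h
      refine ae_ae_of_ae_prod_leb (p := fun t ω => ν t ω = ν' t ω) ?_
      filter_upwards [h, ae_prod_of_ae_forall hνe] with p h1 h2
      rw [h1, h2]
    · intro h
      have hm : MeasurableSet {q : Period T × Ω | ν q.1 q.2 = ν' q.1 q.2} :=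
        measurableSet_eq_fun (hν.1.mono (optionalSigma_le hT ℱ) le_rfl)
          (hν'.1.mono (optionalSigma_le hT ℱ) le_rfl)
      filter_upwards [ae_prod_of_ae_ae hm h, ae_prod_of_ae_forall hνe] with p h1 h2
      rw [h1, h2]
  rw [hνν']
  constructor
  · intro hclear
    have hzero : ∀ i, ∀ᵐ ω ∂P, ∀ᵐ t ∂(leb T), ν' t ω i - ν t ω i = 0 := by
      intro i
      -- Under clearing both aggregates vanish, so the zero process has as drift a positive multiple
      -- of ν' - ν, which is optional as the uniqueness of drifts requires.
      have h1 : Driven ℱ P (horizon hT) (fun _ _ => 0)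
          (fun t ω => ((L i i)⁻¹ * (((N : ℝ) - 1) / 2)) * (ν' t ω i - ν t ω i)) := by
        refine (hd i).congr ?_ ?_
        · filter_upwards [hclear] with ω h t
          exact congrFun (h t).2 i
        · filter_upwards [hclear, hνe] with ω h h2
          refine Eventually.of_forall fun t => ?_
          have hX0 : X t ω = 0 := (h t).1
          have hx0 : x t ω = 0 := (h t).2
          rw [hdrift, hX0, hx0, h2 t]
          simp only [Matrix.mulVec_zero, Pi.zero_apply]
          ring
      have h2 := h1.drift_eq_zero hT (isTop_horizon hT)
        (((hν'.sub hν).sqIntegrableVec hT i).const_mul _)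
        (((hν'.sub hν).1.apply i).const_mul _)
      filter_upwards [h2] with ω h3
      filter_upwards [h3] with t h4
      refine (mul_eq_zero.1 h4).resolve_left ?_
      have := hl i
      positivity
    filter_upwards [ae_all_iff.2 hzero] with ω h1
    filter_upwards [ae_all_iff.2 h1] with t h2
    funext i
    linarith [h2 i]
  · intro hνeq
    -- For ν = ν_n the inhomogeneous term drops out. Zero aggregate rates then force zero aggregate
    -- holdings, since the latter are primitives of the former.
    have h1 := eq_zero_of_driven_homogeneous hT hr hδ hS.posSemidef hl hx hxo fun i => by
      refine (hd i).congr (Eventually.of_forall fun ω t => rfl) ?_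
      filter_upwards [hνeq, hνe, hXx] with ω h2 h3 h4
      filter_upwards [h2] with t h5
      have h6 : X t ω = fun j => primitive (fun t ω => x t ω j) t ω := funext fun j => h4 t j
      rw [hdrift, h3 t, h5, h6]
      ring
    filter_upwards [h1, hXx] with ω h2 h3 t
    refine ⟨?_, funext fun i => h2 t i⟩
    funext i
    refine (h3 t i).trans ?_
    simp [primitive, h2]

end PriceImpactProcess

end PriceImpact

end

theorem lemma4p1 {Ω : Type*} {mΩ : MeasurableSpace Ω} (P : Measure Ω) [IsProbabilityMeasure P]
    (T : ℝ) (hT : 0 < T) (ℱ : Filtration (Period T) mΩ) (r : ℝ) (hr : 0 ≤ r)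
    (d N : ℕ) (hN : 2 ≤ N) (n : Fin N)
    (S L : Matrix (Fin d) (Fin d) ℝ) (hS : S.PosDef) (hL : L.PosDef) (hLdiag : L.IsDiag)
    -- common risk tolerance
    (δ : Fin N → ℝ) (δbar : ℝ) (hδbar : 0 < δbar) (hδ : ∀ m, δ m = δbar)
    -- exposures, and the demand of the noise traders
    (ζ : Fin N → Proc T Ω d) (hζ : ∀ m, MemHInf ℱ P (ζ m))
    (ψ ψdot aψ : Proc T Ω d) (hψ : MemWA ℱ P ψ ψdot aψ)
    -- an admissible demand of investor `n`
    (φ φdot aφ : Proc T Ω d) (hφ : MemWA ℱ P φ φdot aφ) :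
    -- the adjusted objective is a well-defined real number
    IsIntegrand P (adjustedIntegrand r δbar S L ζ n φ φdot ψ ψdot aψ) ∧
    -- the price-impact process is a return process in the admissible class
    (∃ ν : Proc T Ω d, MemHInf ℱ P ν ∧
      ∀ᵐ p ∂((leb T).prod P),
        ν p.1 p.2 = impactReturn r δbar S L ζ n φ φdot aφ ψ ψdot aψ p.1 p.2) ∧
    ∀ ν : Proc T Ω d, MemHInf ℱ P ν →
      -- the other investors follow their competitive strategies under the returns `ν`
      ∀ θ θdot : Fin N → Proc T Ω d,
      (∀ m, m ≠ n → SolvesCompetitiveFBSDE ℱ P r (δ m) S L (ζ m) ν (θ m) (θdot m)) →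
      -- the market clears exactly when the returns are the price-impact process
      (MarketClears P n φ φdot θ θdot ψ ψdot ↔
        ∀ᵐ p ∂((leb T).prod P),
          ν p.1 p.2 = impactReturn r δbar S L ζ n φ φdot aφ ψ ψdot aψ p.1 p.2) ∧
      -- and then the objective takes the adjusted form
      (MarketClears P n φ φdot θ θdot ψ ψdot →
        IsIntegrand P (frIntegrand r (δ n) S L (ζ n) ν φ φdot) ∧
        frObjective P r (δ n) S L (ζ n) ν φ φdot =
          adjustedObjective P r δbar S L ζ n φ φdot ψ ψdot aψ) := by 
  have hδ' : δ = fun _ => δbar := funext hδ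
  subst hδ'
  obtain ⟨ν', hν', hνe⟩ := exists_memHInf_impactReturn (r := r) (δ := δbar) (S := S) (L := L)
    (n := n) hT hζ hψ hφ
  refine ⟨isIntegrand_adjustedIntegrand hT hζ hψ hφ, ⟨ν', hν', ?_⟩, fun ν hν θ θdot hθ => ?_⟩
  · filter_upwards [ae_prod_of_ae_forall hνe] with p hp using hp.symm
  · have hiff := marketClears_iff hT hr hδbar hN hS hL hLdiag hζ hψ hφ hν hθ
    exact ⟨hiff, fun hclear =>
      frObjective_eq_adjustedObjective hT hLdiag hζ hψ hφ (hiff.1 hclear)⟩
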